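/- Let $(M,g)$ be a smooth four-dimensional Lorentzian manifold of signature $(+,-,-,-)$ with Levi-Civita connection $\nabla$, let $U\subseteq M$ be an open region carrying a smooth orthonormal tetrad, and hence a spin frame, and use two-component spinors on $U$ with $a=AA'$, $g_{ab}=\varepsilon_{AB}\bar\varepsilon_{A'B'}$ and $$e_{abcd}=i\varepsilon_{AC}\varepsilon_{BD}\bar\varepsilon_{A'D'}\bar\varepsilon_{B'C'}-i\varepsilon_{AD}\varepsilon_{BC}\bar\varepsilon_{A'C'}\bar\varepsilon_{B'D'},\qquad e_{abcd}e^{abcd}=-24 .$$ Suppose that on $U$ one has $T_{abc}=\Phi_{ABC}\bar\Phi_{A'B'C'}$ for some smooth totally symmetric spinor field $\Phi_{ABC}$, that $\nabla^aT_{abc}=0$, and that $T_{acd}T_b{}^{cd}T^a{}_{ef}T^{bef}\neq0$ at every point of $U$ (the field is of type I). Put $$S^h=\frac{e^{haef}\,T_{emn}T^{bmn}T_b{}^{cd}\nabla_fT_{acd}}{T_{acd}T_b{}^{cd}T^a{}_{ef}T^{bef}} .$$ Then the following are equivalent: 1. $T_{abc}$ can be written locally as $T_{abc}=\Psi_{ABC}\bar\Psi_{A'B'C'}$,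 that is, on a neighbourhood of each point of $U$, for some smooth totally symmetric spinor field $\Psi_{ABC}$ with $\nabla^{AA'}\Psi_{ABC}=0$; 2. $\nabla_aS_b=\nabla_bS_a$ on $U$. If moreover $U$ is simply connected, then condition 2 holds if and only if such a $\Psi_{ABC}$ exists on all of $U$. -/

import Mathlib

open scoped Manifold ContDiff ComplexConjugate Bundle

noncomputable section

namespace RainichThree

/-- The model space of four-dimensional spacetimes. -/
abbrev E4 : Type := EuclideanSpace ℝ (Fin 4)

/-! ### Spacetimes: Lorentzian metrics, Levi-Civita connections, orthonormal tetrads -/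

/-- The Minkowski matrix `diag(1, -1, -1, -1)`. -/
def minkowski (μ ν : Fin 4) : ℝ := if μ = ν then (if μ = 0 then 1 else -1) else 0

/-- A smooth Lorentzian metric, of signature `(+,-,-,-)`, on a four-dimensional manifold. -/
structure LorentzMetric (M : Type*) [TopologicalSpace M] [ChartedSpace E4 M]
    [IsManifold 𝓘(ℝ, E4) ∞ M] where
  /-- The bilinear form on each tangent space. -/
  inner (x : M) : TangentSpace 𝓘(ℝ, E4) x →L[ℝ] TangentSpace 𝓘(ℝ, E4) x →L[ℝ] ℝ
  symm (x : M) (v w : TangentSpace 𝓘(ℝ, E4) x) : inner x v w = inner x w v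
  lorentzian (x : M) : ∃ b : Module.Basis (Fin 4) ℝ (TangentSpace 𝓘(ℝ, E4) x),
    ∀ μ ν, inner x (b μ) (b ν) = minkowski μ ν
  contMDiff : ContMDiff 𝓘(ℝ, E4) (𝓘(ℝ, E4).prod 𝓘(ℝ, E4 →L[ℝ] E4 →L[ℝ] ℝ)) ∞
    (fun x ↦ Bundle.TotalSpace.mk' (E4 →L[ℝ] E4 →L[ℝ] ℝ) x (inner x))

variable {M : Type*} [TopologicalSpace M] [ChartedSpace E4 M] [IsManifold 𝓘(ℝ, E4) ∞ M]

/-- A connection on the tangent bundle is the Levi-Civita connection of `g` if it is torsion-free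
and `d(g(Y, Z)) = g(∇Y, Z) + g(Y, ∇Z)`. (There is exactly one such connection, up to its junk
values on non-differentiable vector fields.) -/
structure IsLeviCivita (g : LorentzMetric M)
    (cov : CovariantDerivative 𝓘(ℝ, E4) E4 (TangentSpace 𝓘(ℝ, E4) : M → Type)) : Prop where
  torsion_free : cov.torsion = 0
  metric (x : M) (Y Z : Π y : M, TangentSpace 𝓘(ℝ, E4) y)
    (hY : MDifferentiableAt 𝓘(ℝ, E4) (𝓘(ℝ, E4).prod 𝓘(ℝ, E4))
      (fun y ↦ Bundle.TotalSpace.mk' E4 y (Y y)) x)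
    (hZ : MDifferentiableAt 𝓘(ℝ, E4) (𝓘(ℝ, E4).prod 𝓘(ℝ, E4))
      (fun y ↦ Bundle.TotalSpace.mk' E4 y (Z y)) x) (v : TangentSpace 𝓘(ℝ, E4) x) :
    mvfderiv 𝓘(ℝ, E4) (fun y ↦ g.inner y (Y y) (Z y)) x v
      = g.inner x (cov Y x v) (Z x) + g.inner x (Y x) (cov Z x v)

/-- A smooth orthonormal tetrad on the region `U`. It determines, up to an overall sign, a spin
frame `(ε_0, ε_1)`, to which all spinor components below refer. -/
structure SpinFrame (g : LorentzMetric M) (U : Set M) where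
  /-- The four vector fields `e_0, e_1, e_2, e_3`. -/
  e (μ : Fin 4) (x : M) : TangentSpace 𝓘(ℝ, E4) x
  contMDiffOn (μ : Fin 4) : ContMDiffOn 𝓘(ℝ, E4) (𝓘(ℝ, E4).prod 𝓘(ℝ, E4)) ∞
    (fun x ↦ Bundle.TotalSpace.mk' E4 x (e μ x)) U
  orthonormal (x : M) (hx : x ∈ U) (μ ν : Fin 4) : g.inner x (e μ x) (e ν x) = minkowski μ ν

/-! ### Spinor and tensor indices -/

/-- A tensor index `a = AA'`: a pair of an unprimed and a primed spinor index. Tensor components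
refer to the null tetrad `e_{AA'}` built from the orthonormal tetrad (see `infeld`). -/
abbrev Idx : Type := Fin 2 × Fin 2

/-- The components of `ε_{AB}`, with `ε_{01} = 1`. The components of `ε^{AB}`, `ε_{A'B'}` and
`ε^{A'B'}` are the same numbers. Indices move by `ξ^A = ε^{AB} ξ_B`, `ξ_B = ξ^A ε_{AB}`. -/
def eps (A B : Fin 2) : ℂ := !![0, 1; -1, 0] A B

/-- The components of `g_{ab} = ε_{AB} ε_{A'B'}`; those of `g^{ab}` are the same numbers. -/
def met (a b : Idx) : ℂ := eps a.1 b.1 * eps a.2 b.2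

/-- The components of the completely antisymmetric tensor
`e_{abcd} = i ε_{AC} ε_{BD} ε_{A'D'} ε_{B'C'} - i ε_{AD} ε_{BC} ε_{A'C'} ε_{B'D'}`;
those of `e^{abcd}` are the same numbers. -/
def vol (a b c d : Idx) : ℂ :=
  Complex.I * eps a.1 c.1 * eps b.1 d.1 * eps a.2 d.2 * eps b.2 c.2
    - Complex.I * eps a.1 d.1 * eps b.1 c.1 * eps a.2 c.2 * eps b.2 d.2

/-- The Infeld-van der Waerden symbols `σ_{AA'}^μ`: identity and Pauli matrices over `√2`.
The null tetrad is `e_{AA'} = ∑ μ, σ_{AA'}^μ e_μ`, so that `g(e_{AA'}, e_{BB'}) = ε_{AB} ε_{A'B'}`. -/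
def infeld (a : Idx) (μ : Fin 4) : ℂ :=
  (1 / (Real.sqrt 2 : ℂ)) *
    (![!![1, 0; 0, 1], !![0, 1; 1, 0], !![0, -Complex.I; Complex.I, 0], !![1, 0; 0, -1]] μ) a.1 a.2

/-- Components of a spinor field with three lower unprimed indices. -/
abbrev Spinor3 (M : Type*) : Type _ := M → Fin 2 → Fin 2 → Fin 2 → ℂ

/-- `Φ_{ABC}` is totally symmetric at `x`. -/
def IsSymmSpinor (Φ : Spinor3 M) (x : M) : Prop :=
  ∀ A B C, Φ x A B C = Φ x B A C ∧ Φ x A B C = Φ x A C B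

/-- A spinor field is smooth on `U` if its components are. -/
def SmoothSpinorOn (Φ : Spinor3 M) (U : Set M) : Prop :=
  ∀ A B C, ContMDiffOn 𝓘(ℝ, E4) 𝓘(ℝ, ℂ) ∞ (fun x ↦ Φ x A B C) U

/-- Components of a tensor field with three lower indices. -/
abbrev Tensor3 (M : Type*) : Type _ := M → Idx → Idx → Idx → ℂ

/-- The tensor `Φ_{ABC} Φ̄_{A'B'C'}`. -/
def superenergy (Φ : Spinor3 M) : Tensor3 M := fun x a b c ↦
  Φ x a.1 b.1 c.1 * conj (Φ x a.2 b.2 c.2)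

/-! ### Covariant derivatives of spinor and tensor components -/

section Derivatives

variable {g : LorentzMetric M} {U : Set M}
  (cov : CovariantDerivative 𝓘(ℝ, E4) E4 (TangentSpace 𝓘(ℝ, E4) : M → Type))
  (F : SpinFrame g U)

/-- The derivative `e_{AA'}(f)` of a complex function along a vector of the null tetrad. -/
def frameDeriv (a : Idx) (f : M → ℂ) (x : M) : ℂ :=
  ∑ μ, infeld a μ * mvfderiv 𝓘(ℝ, E4) f x (F.e μ x)

/-- The connection coefficients `Γ_{abc} = g(∇_{e_a} e_b, e_c)` in the null tetrad. -/
def conn (x : M) (a b c : Idx) : ℂ :=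
  ∑ μ, ∑ ν, ∑ ρ, infeld a μ * infeld b ν * infeld c ρ *
    ((g.inner x (cov (F.e ν) x (F.e μ x)) (F.e ρ x) : ℝ) : ℂ)

/-- The coefficients `Γ_{ab}^c`, so that `∇_{e_a} e_b = Γ_{ab}^c e_c`. -/
def connUp (x : M) (a b c : Idx) : ℂ := ∑ d, met c d * conn cov F x a b d

/-- The spin connection coefficients `γ_{aBC} = ½ ε^{B'C'} Γ_{a BB' CC'}`. They are the unique
ones with `Γ_{a BB' CC'} = γ_{aBC} ε_{B'C'} + ε_{BC} γ̄_{aB'C'}`, that is, `∇_a ε_{BC} = 0`. -/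
def spinConn (x : M) (a : Idx) (B C : Fin 2) : ℂ :=
  (1 / 2) * ∑ P, ∑ Q, eps P Q * conn cov F x a (B, P) (C, Q)

/-- The coefficients `γ_{aB}^C = ε^{CD} γ_{aBD}`, so that `∇_a ε_B = γ_{aB}^C ε_C` for the spin
frame `(ε_0, ε_1)`. -/
def spinConnUp (x : M) (a : Idx) (B C : Fin 2) : ℂ := ∑ D, eps C D * spinConn cov F x a B D

/-- `∇_d Φ_{ABC}`. -/
def nablaSpinor (Φ : Spinor3 M) (x : M) (d : Idx) (A B C : Fin 2) : ℂ :=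
  frameDeriv F d (fun y ↦ Φ y A B C) x
    - ∑ D, (spinConnUp cov F x d A D * Φ x D B C + spinConnUp cov F x d B D * Φ x A D C
      + spinConnUp cov F x d C D * Φ x A B D)

/-- `∇_d T_{abc}`. -/
def nablaTensor (T : Tensor3 M) (x : M) (d a b c : Idx) : ℂ :=
  frameDeriv F d (fun y ↦ T y a b c) x
    - ∑ p, (connUp cov F x d a p * T x p b c + connUp cov F x d b p * T x a p c
      + connUp cov F x d c p * T x a b p)

/-- `∇_a S_b`. -/
def nablaCovector (S : M → Idx → ℂ) (x : M) (a b : Idx) : ℂ :=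
  frameDeriv F a (fun y ↦ S y b) x - ∑ c, connUp cov F x a b c * S x c

/-- The divergence `∇^a T_{abc}`. -/
def divTensor (T : Tensor3 M) (x : M) (b c : Idx) : ℂ :=
  ∑ a, ∑ d, met a d * nablaTensor cov F T x d a b c

/-- The left-hand side `∇^{AA'} Ψ_{ABC}` of the massless spin-3/2 field equation. -/
def divSpinor (Ψ : Spinor3 M) (x : M) (A₁ B C : Fin 2) : ℂ :=
  ∑ A, ∑ D, ∑ D₁, eps A D * eps A₁ D₁ * nablaSpinor cov F Ψ x (D, D₁) A B C

/-! ### The covector built from the tensor -/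

/-- `T_b^{cd}`. -/
def raiseTwo (T : Tensor3 M) (x : M) (b c d : Idx) : ℂ :=
  ∑ p, ∑ q, met c p * met d q * T x b p q

/-- `Q_{ab} = T_{acd} T_b^{cd}`. -/
def quad (T : Tensor3 M) (x : M) (a b : Idx) : ℂ :=
  ∑ c, ∑ d, T x a c d * raiseTwo T x b c d

/-- The scalar `T_{acd} T_b^{cd} T^a_{ef} T^{bef} = Q_{ab} Q^{ab}`. -/
def quartic (T : Tensor3 M) (x : M) : ℂ :=
  ∑ a, ∑ b, ∑ p, ∑ q, met a p * met b q * quad T x a b * quad T x p q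

/-- The vector
`S^h = e^{haef} T_{emn} T^{bmn} T_b^{cd} ∇_f T_{acd} / (T_{acd} T_b^{cd} T^a_{ef} T^{bef})`. -/
def vectorS (T : Tensor3 M) (x : M) (h : Idx) : ℂ :=
  (∑ a, ∑ e, ∑ f, vol h a e f *
    ∑ b, (∑ p, met b p * quad T x e p) *
      ∑ c, ∑ d, raiseTwo T x b c d * nablaTensor cov F T x f a c d) / quartic T x

/-- `S_a = g_{ah} S^h`. -/
def covectorS (T : Tensor3 M) (x : M) (a : Idx) : ℂ := ∑ h, met a h * vectorS cov F T x h

/-- `T = Ψ Ψ̄` on `V` for the symmetric spinor field `Ψ`, smooth on `V`, which solves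
`∇^{AA'} Ψ_{ABC} = 0` there. -/
structure IsMasslessFactor (T : Tensor3 M) (V : Set M) (Ψ : Spinor3 M) : Prop where
  smooth : SmoothSpinorOn Ψ V
  symm (x : M) (hx : x ∈ V) : IsSymmSpinor Ψ x
  factor (x : M) (hx : x ∈ V) : T x = superenergy Ψ x
  field_eq (x : M) (hx : x ∈ V) (A₁ B C : Fin 2) : divSpinor cov F Ψ x A₁ B C = 0

end Derivatives

end RainichThree

end

noncomputable section

namespace RainichThree

/-! ### Algebra of totally symmetric spinors at a point -/

/-! Multiplying Φ by a phase leaves T unchanged, so the question is whether some phase turns Φ into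
a massless field.

The quartic invariant of T is ΔΔ̄, where Δ is the discriminant of the cubic Φ_{ABC} (`quartic_eq`),
so type I means Δ ≠ 0. The cubic covariant Θ of Φ then inverts Φ: Φ_{ACD} Θ_H^{CD} = -(Δ/2) ε_{AH}
(`Cubic.IsSymm.sum_mul_jacobian`).

By the Leibniz rule, ∇^a T_{abc} = 0 relates the divergence of Φ, multiplied by Φ̄, to its
conjugate, multiplied by Φ. Contraction with Θ̄ solves for the divergence of Φ: it is -2 times the
contraction of Φ with a covector w (`rotation`, `spinorDiv_nablaSpinor`). Contraction with Θ as well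
shows that w is anti-Hermitian (`conj_rotation_swap`), so -2iw is a real covector. Therefore e^{iθ}Φ
is massless as soon as ∇θ = -2iw (`exists_isMasslessFactor`).

The same contractions evaluate S: one term of e_{abcd} produces w, the other the logarithmic
derivative of Δ, and S = -2iw + ¼ ∇ arg Δ (`covectorS_superenergy`). The last term is locally a
gradient, so if S is closed then so is -2iw, and the Poincaré lemma gives θ locally. On a simply
connected region the local primitives are glued by lifting the identity to a covering space
(`exists_glued_primitive`).

Conversely, S depends on T alone, so it can be computed from a massless Ψ instead of Φ. There w = 0,
and S is locally a gradient. -/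

@[simp] lemma eps_zero_zero : eps 0 0 = 0 := rfl
@[simp] lemma eps_zero_one : eps 0 1 = 1 := rfl
@[simp] lemma eps_one_zero : eps 1 0 = -1 := rfl
@[simp] lemma eps_one_one : eps 1 1 = 0 := rfl

/-- Components of a spinor with three lower indices at a point. -/
abbrev Cubic : Type := Fin 2 → Fin 2 → Fin 2 → ℂ

namespace Cubic

/-- Total symmetry. -/
def IsSymm (P : Cubic) : Prop := ∀ A B C, P A B C = P B A C ∧ P A B C = P A C B

/-- `P_B^{CD}`. -/
def raise (P : Cubic) (B C D : Fin 2) : ℂ := ∑ p, ∑ q, eps C p * eps D q * P B p q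

/-- The Hessian covariant `P_{ACD} P_B^{CD}`. -/
def hessian (P : Cubic) (A B : Fin 2) : ℂ := ∑ C, ∑ D, P A C D * raise P B C D

/-- The discriminant, normalised as `φ_{AB} φ^{AB}` with `φ` the Hessian. -/
def disc (P : Cubic) : ℂ :=
  2 * (hessian P 0 0 * hessian P 1 1 - hessian P 0 1 * hessian P 0 1)

/-- The cubic covariant `φ_E^B P_{BCD}` with indices `C`, `D` raised, where `φ` is the Hessian. -/
def jacobian (P : Cubic) (E C D : Fin 2) : ℂ :=
  ∑ B, ∑ q, eps B q * hessian P E B * raise P q C D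

variable {P : Cubic}

lemma IsSymm.eqs (hP : IsSymm P) : P 0 1 0 = P 0 0 1 ∧ P 1 0 0 = P 0 0 1 ∧ P 1 0 1 = P 0 1 1 ∧
    P 1 1 0 = P 0 1 1 :=
  ⟨(hP 0 1 0).2, (hP 1 0 0).1.trans (hP 0 1 0).2, (hP 1 0 1).1,
    (hP 1 1 0).2.trans (hP 1 0 1).1⟩

lemma IsSymm.hessian_one_zero (hP : IsSymm P) : hessian P 1 0 = hessian P 0 1 := by
  obtain ⟨h1, h2, h3, h4⟩ := hP.eqs
  simp [hessian, raise, Fin.sum_univ_two, h1, h2, h3, h4]; ring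

/-- The symmetric part would be a covariant of degree 4 and order 2, and a binary cubic has none;
what remains is ε times an invariant of degree 4, a multiple of the discriminant. When the
discriminant is nonzero this inverts `P`. -/
lemma IsSymm.sum_mul_jacobian (hP : IsSymm P) (A H : Fin 2) :
    ∑ C, ∑ D, P A C D * jacobian P H C D = -(disc P / 2) * eps A H := by
  obtain ⟨h1, h2, h3, h4⟩ := hP.eqs
  fin_cases A <;> fin_cases H <;>
    simp [jacobian, disc, hessian, raise, Fin.sum_univ_two, h1, h2, h3, h4] <;> ring

/-- The contraction `N_{ACD} Θ_E^{CD}` of a spinor with the cubic covariant `Θ` of `P`. -/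
def pair (P N : Cubic) (A E : Fin 2) : ℂ := ∑ C, ∑ D, jacobian P E C D * N A C D

/-- The polarisation of the discriminant: its derivative at `P` in the direction `N`. -/
def discDeriv (P N : Cubic) : ℂ := -4 * ∑ A, ∑ E, eps A E * pair P N A E

lemma IsSymm.pair_self (hP : IsSymm P) (A E : Fin 2) : pair P P A E = -(disc P / 2) * eps A E := by
  rw [← hP.sum_mul_jacobian]
  simp only [pair, mul_comm]

/-- With one index raised, a symmetric 2×2 form is trace-free, so by Cayley–Hamilton its square is a
multiple of the identity. -/
lemma IsSymm.hessian_up_mul_hessian (hP : IsSymm P) (A E : Fin 2) :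
    ∑ B, ∑ q, eps B q * hessian P E q * hessian P A B = disc P / 2 * eps A E := by
  have h := hP.hessian_one_zero
  fin_cases A <;> fin_cases E <;> simp [disc, Fin.sum_univ_two, h] <;> ring

end Cubic

/-! ### The covector `S` of a tensor `P_{ABC} Q_{A'B'C'}` -/

section Algebra

variable {M : Type*} {T : Tensor3 M} {x : M} {P Q : Cubic}

open RainichThree.Cubic

/-- The primed factor is an independent cubic `Q` rather than the conjugate of `P`: the algebra is
polynomial in both, and each identity serves for either factor. Contractions over tensor indices
then factorise. -/
lemma raiseTwo_eq (hT : T x = fun a b c ↦ P a.1 b.1 c.1 * Q a.2 b.2 c.2) (b c d : Idx) :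
    raiseTwo T x b c d = raise P b.1 c.1 d.1 * raise Q b.2 c.2 d.2 := by
  obtain ⟨c, c'⟩ := c
  obtain ⟨d, d'⟩ := d
  simp only [raiseTwo, hT, met, raise, Fintype.sum_prod_type, Fin.sum_univ_two]
  fin_cases c <;> fin_cases c' <;> fin_cases d <;> fin_cases d' <;> simp

lemma sum_mul_raise (a b c d : Fin 2 → Fin 2 → ℂ) :
    ∑ p : Idx, ∑ q : Idx, a p.1 q.1 * b p.2 q.2 * (c p.1 q.1 * d p.2 q.2)
      = (∑ p, ∑ q, a p q * c p q) * ∑ p, ∑ q, b p q * d p q := by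
  simp only [Fintype.sum_prod_type, Fin.sum_univ_two]
  ring

lemma quad_eq (hT : T x = fun a b c ↦ P a.1 b.1 c.1 * Q a.2 b.2 c.2) (a b : Idx) :
    quad T x a b = hessian P a.1 b.1 * hessian Q a.2 b.2 := by
  simp only [quad, raiseTwo_eq hT, hessian]
  rw [hT, ← sum_mul_raise]

lemma quartic_eq (hP : P.IsSymm) (hQ : Q.IsSymm)
    (hT : T x = fun a b c ↦ P a.1 b.1 c.1 * Q a.2 b.2 c.2) :
    quartic T x = disc P * disc Q := by
  simp only [quartic, quad_eq hT, met, disc, Fintype.sum_prod_type, Fin.sum_univ_two]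
  simp [hP.hessian_one_zero, hQ.hessian_one_zero]
  ring

/-- `N` and `K` stand for the derivatives of the two factors, so the bracket is the Leibniz form of
∇T. -/
lemma sum_raiseTwo_mul (hT : T x = fun a b c ↦ P a.1 b.1 c.1 * Q a.2 b.2 c.2) (N K : Cubic)
    (a b : Idx) :
    ∑ c, ∑ d, raiseTwo T x b c d * (N a.1 c.1 d.1 * Q a.2 c.2 d.2 + P a.1 c.1 d.1 * K a.2 c.2 d.2)
      = (∑ C, ∑ D, raise P b.1 C D * N a.1 C D) * hessian Q a.2 b.2
        + hessian P a.1 b.1 * ∑ C, ∑ D, raise Q b.2 C D * K a.2 C D := by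
  simp only [raiseTwo_eq hT, mul_add, Finset.sum_add_distrib, hessian]
  rw [sum_mul_raise, sum_mul_raise]
  simp only [mul_comm]

lemma sum_met_mul (u v u' v' y z : Fin 2 → ℂ) :
    ∑ b : Idx, (∑ p : Idx, met b p * (u p.1 * v p.2)) * (y b.1 * v' b.2 + u' b.1 * z b.2)
      = (∑ B, ∑ q, eps B q * u q * y B) * (∑ B, ∑ q, eps B q * v q * v' B)
        + (∑ B, ∑ q, eps B q * u q * u' B) * ∑ B, ∑ q, eps B q * v q * z B := by
  simp [met, Fintype.sum_prod_type, Fin.sum_univ_two]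
  ring

lemma sum_hessian_mul_raise (P N : Cubic) (A E : Fin 2) :
    ∑ B, ∑ q, eps B q * hessian P E q * ∑ C, ∑ D, raise P B C D * N A C D = -pair P N A E := by
  simp [pair, jacobian, Fin.sum_univ_two]
  ring

/-- The tensor `Q_e^b T_b^{cd} ∇_f T_{acd}` in terms of spinors. -/
lemma sum_quad_mul (hP : P.IsSymm) (hQ : Q.IsSymm)
    (hT : T x = fun a b c ↦ P a.1 b.1 c.1 * Q a.2 b.2 c.2) (N K : Cubic) (a e : Idx) :
    ∑ b, (∑ p, met b p * quad T x e p) * ∑ c, ∑ d, raiseTwo T x b c d *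
        (N a.1 c.1 d.1 * Q a.2 c.2 d.2 + P a.1 c.1 d.1 * K a.2 c.2 d.2)
      = -(pair P N a.1 e.1 * (disc Q / 2 * eps a.2 e.2)
          + disc P / 2 * eps a.1 e.1 * pair Q K a.2 e.2) := by
  simp only [sum_raiseTwo_mul hT, quad_eq hT]
  rw [sum_met_mul (hessian P e.1) (hessian Q e.2) (hessian P a.1) (hessian Q a.2)
    (fun B ↦ ∑ C, ∑ D, raise P B C D * N a.1 C D) fun B ↦ ∑ C, ∑ D, raise Q B C D * K a.2 C D]
  rw [sum_hessian_mul_raise, sum_hessian_mul_raise, hP.hessian_up_mul_hessian,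
    hQ.hessian_up_mul_hessian]
  ring

/-- The contraction `∇^A_Y P_{ACD} Θ_H^{CD}` of the divergence of `P`. -/
def divPair (P : Cubic) (N : Fin 2 → Cubic) (H : Fin 2) : ℂ :=
  ∑ A, ∑ d, eps A d * pair P (N d) A H

/-- On each half, one term of `vol` contracts the derivative index with the first index of `X` (or
`Y`) and meets ε_{AB}ε^{AB} = 2 on the other half, which turns k/2 into k; the other term takes the
trace. The trace is written with the factor -4 that makes it a `discDeriv`. -/
lemma vol_contraction (X : Idx → Fin 2 → Fin 2 → ℂ) (Y : Idx → Fin 2 → Fin 2 → ℂ) (k l : ℂ)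
    (h : Idx) :
    ∑ g, met h g * ∑ a, ∑ e, ∑ f, vol g a e f *
        -(X f a.1 e.1 * (k / 2 * eps a.2 e.2) + l / 2 * eps a.1 e.1 * Y f a.2 e.2)
      = -Complex.I * (k * (∑ A, ∑ d, eps A d * X (d, h.2) A h.1)
          - l * ∑ A, ∑ d, eps A d * Y (h.1, d) A h.2)
        - Complex.I / 8 * (k * (-4 * ∑ A, ∑ E, eps A E * X h A E)
          - l * (-4 * ∑ A, ∑ E, eps A E * Y h A E)) := by
  obtain ⟨h, h'⟩ := h
  simp only [met, vol, Fintype.sum_prod_type, Fin.sum_univ_two]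
  fin_cases h <;> fin_cases h' <;> simp <;> ring

/-- The divergence `∇^A P_{ABC}`. -/
def spinorDiv (N : Fin 2 → Cubic) (B C : Fin 2) : ℂ := ∑ A, ∑ d, eps A d * N d A B C

lemma divPair_eq (P : Cubic) (N : Fin 2 → Cubic) (H : Fin 2) :
    divPair P N H = ∑ B, ∑ C, jacobian P H B C * spinorDiv N B C := by
  simp [divPair, spinorDiv, pair, Fin.sum_univ_two]
  ring

lemma sum_met_prod (N K : Idx → Cubic) (P Q : Cubic) (b c : Idx) :
    ∑ a, ∑ d, met a d * (N d a.1 b.1 c.1 * Q a.2 b.2 c.2 + P a.1 b.1 c.1 * K d a.2 b.2 c.2)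
      = (∑ A, ∑ Y, eps A Y * Q A b.2 c.2 * spinorDiv (fun d ↦ N (d, Y)) b.1 c.1)
        + ∑ A, ∑ X, eps A X * P A b.1 c.1 * spinorDiv (fun d ↦ K (X, d)) b.2 c.2 := by
  simp [met, spinorDiv, Fintype.sum_prod_type, Fin.sum_univ_two]
  ring

/-- Contraction of the identity `χ_Y Q^Y + P^X χ'_X = 0` with the cubic covariant of `Q`. -/
lemma spinorDiv_eq_of_div_eq_zero (hQ : Q.IsSymm) (hQ' : disc Q ≠ 0) (N K : Idx → Cubic)
    (h : ∀ b c : Idx, ∑ a, ∑ d, met a d *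
      (N d a.1 b.1 c.1 * Q a.2 b.2 c.2 + P a.1 b.1 c.1 * K d a.2 b.2 c.2) = 0) (Y B C : Fin 2) :
    spinorDiv (fun d ↦ N (d, Y)) B C
      = 2 * ∑ A, ∑ X, eps A X * P A B C * (divPair Q (fun d ↦ K (X, d)) Y / disc Q) := by
  have h1 : ∑ B', ∑ C', jacobian Q Y B' C' *
      ((∑ A, ∑ Z, eps A Z * Q A B' C' * spinorDiv (fun d ↦ N (d, Z)) B C)
        + ∑ A, ∑ X, eps A X * P A B C * spinorDiv (fun d ↦ K (X, d)) B' C') = 0 :=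
    Finset.sum_eq_zero fun B' _ ↦ Finset.sum_eq_zero fun C' _ ↦ by
      rw [← sum_met_prod N K P Q (B, B') (C, C'), h, mul_zero]
  have h2 : ∑ B', ∑ C', jacobian Q Y B' C' *
      ((∑ A, ∑ Z, eps A Z * Q A B' C' * spinorDiv (fun d ↦ N (d, Z)) B C)
        + ∑ A, ∑ X, eps A X * P A B C * spinorDiv (fun d ↦ K (X, d)) B' C')
      = (∑ A, ∑ Z, eps A Z * pair Q Q A Y * spinorDiv (fun d ↦ N (d, Z)) B C)
        + ∑ A, ∑ X, eps A X * P A B C * divPair Q (fun d ↦ K (X, d)) Y := by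
    simp [divPair_eq, pair, Fin.sum_univ_two]
    ring
  rw [h2] at h1
  -- `Q` contracted with its own covariant is a multiple of ε, which isolates the divergence of `P`.
  simp only [hQ.pair_self] at h1
  have h3 : (∑ A, ∑ Z, eps A Z * (-(disc Q / 2) * eps A Y) * spinorDiv (fun d ↦ N (d, Z)) B C)
      = -(disc Q / 2) * spinorDiv (fun d ↦ N (d, Y)) B C := by
    fin_cases Y <;> simp [Fin.sum_univ_two]
  rw [h3] at h1
  have h4 : ∑ A, ∑ X, eps A X * P A B C * (divPair Q (fun d ↦ K (X, d)) Y / disc Q)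
      = (∑ A, ∑ X, eps A X * P A B C * divPair Q (fun d ↦ K (X, d)) Y) / disc Q := by
    simp only [Finset.sum_div, mul_div_assoc]
  rw [h4]
  field_simp
  linear_combination (-2) * h1

/-- The divergence of `P`, already expressed through `Q`, is contracted once more, with the
covariant of `P`; the contraction of `P` with it is again a multiple of ε. For `Q` the conjugate of
`P` this is anti-Hermiticity of the rotation covector. -/
lemma divPair_div_disc_of_div_eq_zero (hP : P.IsSymm) (hP' : disc P ≠ 0) (hQ : Q.IsSymm)
    (hQ' : disc Q ≠ 0) (N K : Idx → Cubic)
    (h : ∀ b c : Idx, ∑ a, ∑ d, met a d *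
      (N d a.1 b.1 c.1 * Q a.2 b.2 c.2 + P a.1 b.1 c.1 * K d a.2 b.2 c.2) = 0) (a : Idx) :
    divPair P (fun d ↦ N (d, a.2)) a.1 / disc P
      = -(divPair Q (fun d ↦ K (a.1, d)) a.2 / disc Q) := by
  have h2 : divPair P (fun d ↦ N (d, a.2)) a.1
      = 2 * ∑ A, ∑ X, eps A X * pair P P A a.1 *
        (divPair Q (fun d ↦ K (X, d)) a.2 / disc Q) := by
    simp only [divPair_eq P, spinorDiv_eq_of_div_eq_zero hQ hQ' N K h]
    generalize (fun X ↦ divPair Q (fun d ↦ K (X, d)) a.2 / disc Q) = w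
    simp [pair, Fin.sum_univ_two]
    ring
  simp only [hP.pair_self] at h2
  obtain ⟨a, b⟩ := a
  rw [h2]
  fin_cases a <;> simp [Fin.sum_univ_two] <;> field_simp

end Algebra

section CovectorS

variable {M : Type*} [TopologicalSpace M] [ChartedSpace E4 M] [IsManifold 𝓘(ℝ, E4) ∞ M]
  {g : LorentzMetric M} {U : Set M}
  {cov : CovariantDerivative 𝓘(ℝ, E4) E4 (TangentSpace 𝓘(ℝ, E4) : M → Type)}
  {F : SpinFrame g U} {T : Tensor3 M} {x : M} {P Q : Cubic}

open RainichThree.Cubic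

/-- Each term of the numerator carries the discriminant of one factor, and the denominator is the
product of both. Division therefore separates `P` from `Q`. -/
lemma covectorS_eq (hP : P.IsSymm) (hP' : disc P ≠ 0) (hQ : Q.IsSymm) (hQ' : disc Q ≠ 0)
    (hT : T x = fun a b c ↦ P a.1 b.1 c.1 * Q a.2 b.2 c.2) (N K : Idx → Cubic)
    (hN : ∀ d a b c, nablaTensor cov F T x d a b c
      = N d a.1 b.1 c.1 * Q a.2 b.2 c.2 + P a.1 b.1 c.1 * K d a.2 b.2 c.2) (h : Idx) :
    covectorS cov F T x h
      = -Complex.I * (divPair P (fun d ↦ N (d, h.2)) h.1 / disc P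
          - divPair Q (fun d ↦ K (h.1, d)) h.2 / disc Q)
        - Complex.I / 8 * (discDeriv P (N h) / disc P - discDeriv Q (K h) / disc Q) := by
  simp only [covectorS, vectorS, hN, sum_quad_mul hP hQ hT]
  simp only [← mul_div_assoc]
  rw [← Finset.sum_div]
  rw [vol_contraction (fun f ↦ pair P (N f)) (fun f ↦ pair Q (K f)), quartic_eq hP hQ hT]
  simp only [divPair, discDeriv]
  field_simp

end CovectorS

end RainichThree

namespace RainichThree

/-! ### The chain rule for vector-valued functions on the manifold -/

section ChainRule

variable {M : Type*} [TopologicalSpace M] [ChartedSpace E4 M] {x : M}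

/-- The chain rule. -/
lemma mvfderiv_comp_eq {V W : Type*} [NormedAddCommGroup V] [NormedSpace ℝ V]
    [NormedAddCommGroup W] [NormedSpace ℝ W] {f : M → V} {k : V → W} {k' : V →L[ℝ] W}
    (hf : MDifferentiableAt 𝓘(ℝ, E4) 𝓘(ℝ, V) f x) (hk : HasFDerivAt k k' (f x))
    (v : TangentSpace 𝓘(ℝ, E4) x) :
    mvfderiv 𝓘(ℝ, E4) (fun y ↦ k (f y)) x v = k' (mvfderiv 𝓘(ℝ, E4) f x v) := by
  have := (hk.hasMFDerivAt.comp x hf.hasMFDerivAt).mfderiv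
  simp only [mvfderiv]
  rw [show (fun y ↦ k (f y)) = k ∘ f from rfl, this]
  rfl

lemma mdifferentiableAt_comp_eq {V W : Type*} [NormedAddCommGroup V] [NormedSpace ℝ V]
    [NormedAddCommGroup W] [NormedSpace ℝ W] {f : M → V} {k : V → W} {k' : V →L[ℝ] W}
    (hf : MDifferentiableAt 𝓘(ℝ, E4) 𝓘(ℝ, V) f x) (hk : HasFDerivAt k k' (f x)) :
    MDifferentiableAt 𝓘(ℝ, E4) 𝓘(ℝ, W) (fun y ↦ k (f y)) x :=
  (hk.hasMFDerivAt.comp x hf.hasMFDerivAt).mdifferentiableAt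

end ChainRule

variable {M : Type*} [TopologicalSpace M] [ChartedSpace E4 M] [IsManifold 𝓘(ℝ, E4) ∞ M]
  {g : LorentzMetric M} {U : Set M}
  {cov : CovariantDerivative 𝓘(ℝ, E4) E4 (TangentSpace 𝓘(ℝ, E4) : M → Type)}

/-! ### Derivatives along the null tetrad -/

section FrameDeriv

variable (F : SpinFrame g U) {d : Idx} {x : M} {f h : M → ℂ} {a b : ℂ}

/-- `f` is differentiable at `x` and has derivative `a` along the vector `e_d` of the null
tetrad. -/
def HasFrameDeriv (d : Idx) (f : M → ℂ) (a : ℂ) (x : M) : Prop :=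
  MDifferentiableAt 𝓘(ℝ, E4) 𝓘(ℝ, ℂ) f x ∧ frameDeriv F d f x = a

variable {F}

lemma hasFrameDeriv_frameDeriv (hf : MDifferentiableAt 𝓘(ℝ, E4) 𝓘(ℝ, ℂ) f x) :
    HasFrameDeriv F d f (frameDeriv F d f x) x := ⟨hf, rfl⟩

lemma HasFrameDeriv.congr_deriv (hf : HasFrameDeriv F d f a x) (h : a = b) :
    HasFrameDeriv F d f b x := h ▸ hf

lemma frameDeriv_congr (hfh : f =ᶠ[nhds x] h) : frameDeriv F d f x = frameDeriv F d h x := by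
  simp only [frameDeriv, mvfderiv, hfh.mfderiv_eq]
  rfl

lemma HasFrameDeriv.congr_of_eventuallyEq (hf : HasFrameDeriv F d f a x) (hfh : h =ᶠ[nhds x] f) :
    HasFrameDeriv F d h a x :=
  ⟨hf.1.congr_of_eventuallyEq hfh, (frameDeriv_congr hfh).trans hf.2⟩

lemma hasFrameDeriv_const (c : ℂ) : HasFrameDeriv F d (fun _ ↦ c) 0 x :=
  ⟨mdifferentiableAt_const, by simp [frameDeriv, mvfderiv_const]⟩

lemma HasFrameDeriv.comp {k : ℂ → ℂ} {k' : ℂ} (hf : HasFrameDeriv F d f a x)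
    (hk : HasDerivAt k k' (f x)) : HasFrameDeriv F d (fun y ↦ k (f y)) (k' * a) x := by
  have hk' := hk.hasFDerivAt.restrictScalars ℝ
  refine ⟨mdifferentiableAt_comp_eq hf.1 hk', ?_⟩
  rw [← hf.2]
  simp only [frameDeriv, mvfderiv_comp_eq hf.1 hk', Finset.mul_sum]
  refine Finset.sum_congr rfl fun μ _ ↦ ?_
  simp
  ring

lemma HasFrameDeriv.add (hf : HasFrameDeriv F d f a x) (hh : HasFrameDeriv F d h b x) :
    HasFrameDeriv F d (fun y ↦ f y + h y) (a + b) x := by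
  refine ⟨hf.1.add hh.1, ?_⟩
  rw [← hf.2, ← hh.2]
  simp only [frameDeriv]
  rw [mvfderiv_fun_add hf.1 hh.1]
  simp [mul_add, Finset.sum_add_distrib]

lemma HasFrameDeriv.mul (hf : HasFrameDeriv F d f a x) (hh : HasFrameDeriv F d h b x) :
    HasFrameDeriv F d (fun y ↦ f y * h y) (a * h x + f x * b) x := by
  refine ⟨hf.1.mul hh.1, ?_⟩
  have := (hf.1.hasMFDerivAt.mul' hh.1.hasMFDerivAt).mfderiv
  rw [← hf.2, ← hh.2]
  simp only [frameDeriv, mvfderiv, Finset.sum_mul, Finset.mul_sum]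
  rw [show (fun y ↦ f y * h y) = f * h from rfl, this, ← Finset.sum_add_distrib]
  refine Finset.sum_congr rfl fun μ _ ↦ ?_
  have e : ∀ p q v : ℂ, v * (f x * q + p * h x) = v * p * h x + f x * (v * q) := by
    intros; ring
  exact e _ _ _

lemma HasFrameDeriv.const_mul (c : ℂ) (hf : HasFrameDeriv F d f a x) :
    HasFrameDeriv F d (fun y ↦ c * f y) (c * a) x :=
  ((hasFrameDeriv_const c).mul hf).congr_deriv (by ring)

lemma HasFrameDeriv.sub (hf : HasFrameDeriv F d f a x) (hh : HasFrameDeriv F d h b x) :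
    HasFrameDeriv F d (fun y ↦ f y - h y) (a - b) x := by
  have := hf.add (hh.const_mul (-1))
  simp only [neg_mul, one_mul, ← sub_eq_add_neg] at this
  exact this

lemma HasFrameDeriv.sum {ι : Type*} (s : Finset ι) {f : ι → M → ℂ} {a : ι → ℂ}
    (hf : ∀ i ∈ s, HasFrameDeriv F d (f i) (a i) x) :
    HasFrameDeriv F d (fun y ↦ ∑ i ∈ s, f i y) (∑ i ∈ s, a i) x := by
  classical
  induction s using Finset.induction_on with
  | empty => simpa using hasFrameDeriv_const 0
  | insert i s hi ih =>
    simp only [Finset.sum_insert hi]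
    exact (hf i (by simp)).add (ih fun j hj ↦ hf j (by simp [hj]))

/-- The identity and the Pauli matrices are Hermitian. Hence conjugation exchanges the two indices
of a null tetrad vector, the source of every `swap` below. -/
lemma conj_infeld (a : Idx) (μ : Fin 4) : conj (infeld a μ) = infeld a.swap μ := by
  obtain ⟨A, B⟩ := a
  fin_cases μ <;> fin_cases A <;> fin_cases B <;> simp [infeld]

lemma HasFrameDeriv.conj (hf : HasFrameDeriv F d f a x) :
    HasFrameDeriv F d.swap (fun y ↦ conj (f y)) (conj a) x := by
  have hk : HasFDerivAt (fun z : ℂ ↦ conj z) (Complex.conjCLE : ℂ →L[ℝ] ℂ) (f x) :=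
    Complex.conjCLE.hasFDerivAt
  refine ⟨mdifferentiableAt_comp_eq hf.1 hk, ?_⟩
  rw [← hf.2]
  simp only [frameDeriv, mvfderiv_comp_eq hf.1 hk, map_sum, map_mul, conj_infeld]
  rfl

end FrameDeriv

/-! ### Connection coefficients -/

section Connection

variable {F : SpinFrame g U} {x : M}

lemma SpinFrame.contMDiffAt (F : SpinFrame g U) (hU : IsOpen U) (hx : x ∈ U) (μ : Fin 4) :
    ContMDiffAt 𝓘(ℝ, E4) (𝓘(ℝ, E4).prod 𝓘(ℝ, E4)) ∞
      (fun y ↦ Bundle.TotalSpace.mk' E4 y (F.e μ y)) x :=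
  (F.contMDiffOn μ).contMDiffAt (hU.mem_nhds hx)

lemma SpinFrame.mdifferentiableAt (F : SpinFrame g U) (hU : IsOpen U) (hx : x ∈ U) (μ : Fin 4) :
    MDifferentiableAt 𝓘(ℝ, E4) (𝓘(ℝ, E4).prod 𝓘(ℝ, E4))
      (fun y ↦ Bundle.TotalSpace.mk' E4 y (F.e μ y)) x :=
  (F.contMDiffAt hU hx μ).mdifferentiableAt (by simp)

/-- Metric compatibility, applied to the locally constant function g(e_ν, e_ρ). -/
lemma inner_cov_antisymm (hcov : IsLeviCivita g cov) (hU : IsOpen U) (hx : x ∈ U) (μ ν ρ : Fin 4) :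
    g.inner x (cov (F.e ν) x (F.e μ x)) (F.e ρ x)
      = -g.inner x (cov (F.e ρ) x (F.e μ x)) (F.e ν x) := by
  have h := hcov.metric x (F.e ν) (F.e ρ) (F.mdifferentiableAt hU hx ν)
    (F.mdifferentiableAt hU hx ρ) (F.e μ x)
  have h0 : (fun y ↦ g.inner y (F.e ν y) (F.e ρ y)) =ᶠ[nhds x] fun _ ↦ minkowski ν ρ := by
    filter_upwards [hU.mem_nhds hx] with y hy using F.orthonormal y hy ν ρ
  have h1 : mvfderiv 𝓘(ℝ, E4) (fun y ↦ g.inner y (F.e ν y) (F.e ρ y)) x (F.e μ x) = 0 := by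
    have : mvfderiv 𝓘(ℝ, E4) (fun _ : M ↦ minkowski ν ρ) x = 0 := mvfderiv_const _
    simp only [mvfderiv] at this ⊢
    rw [h0.mfderiv_eq]
    exact DFunLike.congr_fun this _
  rw [h1, g.symm x (F.e ν x)] at h
  linarith

lemma conn_antisymm (hcov : IsLeviCivita g cov) (hU : IsOpen U) (hx : x ∈ U) (a b c : Idx) :
    conn cov F x a b c = -conn cov F x a c b := by
  simp only [conn, ← Finset.sum_neg_distrib]
  refine Finset.sum_congr rfl fun μ _ ↦ ?_
  rw [Finset.sum_comm]
  refine Finset.sum_congr rfl fun ν _ ↦ Finset.sum_congr rfl fun ρ _ ↦ ?_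
  rw [inner_cov_antisymm hcov hU hx]
  push_cast
  ring

lemma conj_conn (a b c : Idx) : conj (conn cov F x a b c) = conn cov F x a.swap b.swap c.swap := by
  simp only [conn, map_sum, map_mul, conj_infeld, Complex.conj_ofReal]

/-- The splitting of a bivector into its self-dual and anti-self-dual halves: it is antisymmetric in
exactly one of the two spinor index pairs, and in dimension two that part is a multiple of ε. -/
lemma antisymm_eq_add {K : Idx → Idx → ℂ} (hK : ∀ b c, K b c = -K c b) (b c : Idx) :
    K b c = (1 / 2) * (∑ R, ∑ S, eps R S * K (b.1, R) (c.1, S)) * eps b.2 c.2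
      + eps b.1 c.1 * ((1 / 2) * ∑ R, ∑ S, eps R S * K (R, b.2) (S, c.2)) := by
  obtain ⟨B, P⟩ := b
  obtain ⟨C, Q⟩ := c
  have h0 : ∀ b, K b b = 0 := fun b ↦ by linear_combination (1 / 2) * hK b b
  have h1 := hK (0, 1) (0, 0)
  have h2 := hK (1, 0) (0, 0)
  have h3 := hK (1, 1) (0, 0)
  have h4 := hK (1, 0) (0, 1)
  have h5 := hK (1, 1) (0, 1)
  have h6 := hK (1, 1) (1, 0)
  fin_cases B <;> fin_cases P <;> fin_cases C <;> fin_cases Q <;>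
    simp [Fin.sum_univ_two, h0, h1, h2, h3, h4, h5, h6] <;> ring

lemma conn_eq_spinConn (hcov : IsLeviCivita g cov) (hU : IsOpen U) (hx : x ∈ U) (a b c : Idx) :
    conn cov F x a b c = spinConn cov F x a b.1 c.1 * eps b.2 c.2
      + eps b.1 c.1 * conj (spinConn cov F x a.swap b.2 c.2) := by
  rw [antisymm_eq_add (conn_antisymm hcov hU hx a) b c]
  have : ∀ A B, conj (eps A B) = eps A B := fun A B ↦ by fin_cases A <;> fin_cases B <;> simp
  simp only [spinConn, map_mul, map_sum, conj_conn, this, map_div₀, map_one, map_ofNat,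
    Prod.swap_swap, Prod.swap_prod_mk]

/-- Symmetry makes the spin connection trace-free, so invariants such as the discriminant
differentiate without connection terms. -/
lemma spinConn_symm (hcov : IsLeviCivita g cov) (hU : IsOpen U) (hx : x ∈ U) (a : Idx)
    (B C : Fin 2) : spinConn cov F x a B C = spinConn cov F x a C B := by
  simp only [spinConn, Fin.sum_univ_two, conn_antisymm hcov hU hx a (C, _)]
  simp
  ring

lemma connUp_eq_spinConnUp (hcov : IsLeviCivita g cov) (hU : IsOpen U) (hx : x ∈ U)
    (a b c : Idx) :
    connUp cov F x a b c = spinConnUp cov F x a b.1 c.1 * (if b.2 = c.2 then 1 else 0)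
      + (if b.1 = c.1 then 1 else 0) * conj (spinConnUp cov F x a.swap b.2 c.2) := by
  obtain ⟨B, P⟩ := b
  obtain ⟨C, Q⟩ := c
  simp only [connUp, spinConnUp, conn_eq_spinConn hcov hU hx, met, Fintype.sum_prod_type,
    Fin.sum_univ_two]
  fin_cases B <;> fin_cases P <;> fin_cases C <;> fin_cases Q <;>
    simp [add_comm]

end Connection

/-! ### Covariant derivatives of `Φ_{ABC} Φ̄_{A'B'C'}` -/

section Nabla

variable {F : SpinFrame g U} {x : M} {Φ : Spinor3 M} {T : Tensor3 M}

/-- The connection on a tensor index is the sum of those on its two spinor indices, so the covariant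
derivative obeys the Leibniz rule on the product. -/
lemma nablaTensor_superenergy (hcov : IsLeviCivita g cov) (hU : IsOpen U) (hx : x ∈ U)
    (hΦ : ∀ A B C, MDifferentiableAt 𝓘(ℝ, E4) 𝓘(ℝ, ℂ) (fun y ↦ Φ y A B C) x)
    (hT : T =ᶠ[nhds x] superenergy Φ) (d a b c : Idx) :
    nablaTensor cov F T x d a b c
      = nablaSpinor cov F Φ x d a.1 b.1 c.1 * conj (Φ x a.2 b.2 c.2)
        + Φ x a.1 b.1 c.1 * conj (nablaSpinor cov F Φ x d.swap a.2 b.2 c.2) := by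
  have h1 : HasFrameDeriv F d (fun y ↦ T y a b c) _ x :=
    ((hasFrameDeriv_frameDeriv (hΦ a.1 b.1 c.1)).mul
      (hasFrameDeriv_frameDeriv (d := d.swap) (hΦ a.2 b.2 c.2)).conj).congr_of_eventuallyEq <| by
        filter_upwards [hT] with y hy
        simp [hy, superenergy]
  simp only [nablaTensor, nablaSpinor]
  rw [h1.2, hT.eq_of_nhds]
  simp only [connUp_eq_spinConnUp hcov hU hx, superenergy, Fintype.sum_prod_type, Fin.sum_univ_two]
  obtain ⟨A, A'⟩ := a
  obtain ⟨B, B'⟩ := b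
  obtain ⟨C, C'⟩ := c
  simp only [map_sub, map_add, map_mul]
  fin_cases A <;> fin_cases A' <;> fin_cases B <;> fin_cases B' <;> fin_cases C <;>
    fin_cases C' <;> simp <;> ring

lemma nablaSpinor_symm (hsym : ∀ᶠ y in nhds x, IsSymmSpinor Φ y) (d : Idx) :
    Cubic.IsSymm (nablaSpinor cov F Φ x d) := by
  intro A B C
  have hx := hsym.self_of_nhds
  have h1 := frameDeriv_congr (F := F) (d := d) (hsym.mono fun y hy ↦ (hy A B C).1)
  have h2 := frameDeriv_congr (F := F) (d := d) (hsym.mono fun y hy ↦ (hy A B C).2)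
  -- By symmetry of Φ the summed index can always stand first; permuting A, B, C then only reorders
  -- the three terms.
  have hΓ : ∀ A B C, ∑ D, (spinConnUp cov F x d A D * Φ x D B C
      + spinConnUp cov F x d B D * Φ x A D C + spinConnUp cov F x d C D * Φ x A B D)
      = ∑ D, (spinConnUp cov F x d A D * Φ x D B C + spinConnUp cov F x d B D * Φ x D A C
        + spinConnUp cov F x d C D * Φ x D A B) := fun A B C ↦
    Finset.sum_congr rfl fun D _ ↦ by
      have e1 := (hx A D C).1
      have e2 := (hx A B D).2.trans (hx A D B).1
      rw [e1, e2]
  have hN : ∀ A B C, nablaSpinor cov F Φ x d A B C = frameDeriv F d (fun y ↦ Φ y A B C) x -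
      ∑ D, (spinConnUp cov F x d A D * Φ x D B C + spinConnUp cov F x d B D * Φ x D A C
        + spinConnUp cov F x d C D * Φ x D A B) := fun A B C ↦ by rw [nablaSpinor, hΓ]
  constructor
  · rw [hN, hN B A C, h1]
    refine congrArg _ (Finset.sum_congr rfl fun D _ ↦ ?_)
    rw [(hx D A B).2]
    ring
  · rw [hN, hN A C B, h2]
    refine congrArg _ (Finset.sum_congr rfl fun D _ ↦ ?_)
    rw [(hx D B C).2]
    ring

/-- The discriminant as a polynomial in the components. -/
def discPoly (a b c d : ℂ) : ℂ := 8 * ((a * c - b * b) * (b * d - c * c))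
    - 2 * ((a * d - b * c) * (a * d - b * c))

lemma Cubic.IsSymm.disc_eq {P : Cubic} (hP : P.IsSymm) :
    P.disc = discPoly (P 0 0 0) (P 0 0 1) (P 0 1 1) (P 1 1 1) := by
  obtain ⟨h1, h2, h3, h4⟩ := hP.eqs
  simp [disc, discPoly, hessian, raise, Fin.sum_univ_two, h1, h2, h3, h4]
  ring

/-- The right-hand side is the derivative of `discPoly` along `N`; this identifies the trace of
`pair` with the polarised discriminant. -/
lemma Cubic.IsSymm.discDeriv_eq {P N : Cubic} (hP : P.IsSymm) (hN : N.IsSymm) :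
    P.discDeriv N =
      8 * ((N 0 0 0 * P 0 1 1 + P 0 0 0 * N 0 1 1 - 2 * P 0 0 1 * N 0 0 1)
          * (P 0 0 1 * P 1 1 1 - P 0 1 1 * P 0 1 1)
        + (P 0 0 0 * P 0 1 1 - P 0 0 1 * P 0 0 1)
          * (N 0 0 1 * P 1 1 1 + P 0 0 1 * N 1 1 1 - 2 * P 0 1 1 * N 0 1 1))
      - 4 * ((P 0 0 0 * P 1 1 1 - P 0 0 1 * P 0 1 1)
          * (N 0 0 0 * P 1 1 1 + P 0 0 0 * N 1 1 1 - N 0 0 1 * P 0 1 1 - P 0 0 1 * N 0 1 1)) := by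
  obtain ⟨h1, h2, h3, h4⟩ := hP.eqs
  obtain ⟨k1, k2, k3, k4⟩ := hN.eqs
  simp [discDeriv, pair, jacobian, hessian, raise, Fin.sum_univ_two, h1, h2, h3, h4, k1, k2, k3, k4]
  ring

/-- The derivative of the discriminant of a symmetric spinor field, in terms of its covariant
derivative. -/
lemma hasFrameDeriv_disc (hcov : IsLeviCivita g cov) (hU : IsOpen U) (hx : x ∈ U)
    (hΦ : ∀ A B C, MDifferentiableAt 𝓘(ℝ, E4) 𝓘(ℝ, ℂ) (fun y ↦ Φ y A B C) x)
    (hsym : ∀ᶠ y in nhds x, IsSymmSpinor Φ y) (d : Idx) :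
    HasFrameDeriv F d (fun y ↦ Cubic.disc (Φ y))
      (Cubic.discDeriv (Φ x) (nablaSpinor cov F Φ x d)) x := by
  have hP : Cubic.IsSymm (Φ x) := hsym.self_of_nhds
  have h := fun A B C ↦ hasFrameDeriv_frameDeriv (F := F) (d := d) (hΦ A B C)
  have h1 := ((((((h 0 0 0).mul (h 0 1 1)).sub ((h 0 0 1).mul (h 0 0 1))).mul
    (((h 0 0 1).mul (h 1 1 1)).sub ((h 0 1 1).mul (h 0 1 1)))).const_mul 8).sub
    (((((h 0 0 0).mul (h 1 1 1)).sub ((h 0 0 1).mul (h 0 1 1))).mul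
      (((h 0 0 0).mul (h 1 1 1)).sub ((h 0 0 1).mul (h 0 1 1)))).const_mul 2))
  refine (h1.congr_of_eventuallyEq ?_).congr_deriv ?_
  · filter_upwards [hsym] with y hy
    exact Cubic.IsSymm.disc_eq hy
  · rw [hP.discDeriv_eq (nablaSpinor_symm hsym d)]
    obtain ⟨h1, h2, h3, h4⟩ := hP.eqs
    -- Trace-freeness of the spin connection cancels its contributions, the discriminant being
    -- SL(2)-invariant.
    have hs := spinConn_symm (F := F) hcov hU hx d 1 0
    simp [nablaSpinor, spinConnUp, Fin.sum_univ_two, h1, h2, h3, h4, hs]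
    ring

end Nabla

end RainichThree

namespace RainichThree

section Smooth

variable {M : Type*} [TopologicalSpace M] [ChartedSpace E4 M] {U : Set M}

lemma contMDiffOn_complex_mul {f h : M → ℂ} (hf : ContMDiffOn 𝓘(ℝ, E4) 𝓘(ℝ, ℂ) ∞ f U)
    (hh : ContMDiffOn 𝓘(ℝ, E4) 𝓘(ℝ, ℂ) ∞ h U) :
    ContMDiffOn 𝓘(ℝ, E4) 𝓘(ℝ, ℂ) ∞ (fun x ↦ f x * h x) U :=
  (contDiff_mul (𝕜 := ℝ) (𝔸 := ℂ)).contMDiff.comp_contMDiffOn (hf.prodMk_space hh)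

end Smooth

/-! ### Open sets in chart coordinates -/

section ChartDomain

variable {M : Type*} [TopologicalSpace M] [ChartedSpace E4 M] {U : Set M}

/-- The part of the target of the chart at `x₀` that corresponds to `U`. -/
def chartDomain (U : Set M) (x₀ : M) : Set E4 :=
  (extChartAt 𝓘(ℝ, E4) x₀).target ∩ (extChartAt 𝓘(ℝ, E4) x₀).symm ⁻¹' U

lemma isOpen_chartDomain (x₀ : M) (hU : IsOpen U) : IsOpen (chartDomain U x₀) :=
  (continuousOn_extChartAt_symm x₀).isOpen_inter_preimage (isOpen_extChartAt_target x₀) hU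

end ChartDomain

variable {M : Type*} [TopologicalSpace M] [ChartedSpace E4 M] [IsManifold 𝓘(ℝ, E4) ∞ M]
  {g : LorentzMetric M} {U : Set M}
  {cov : CovariantDerivative 𝓘(ℝ, E4) E4 (TangentSpace 𝓘(ℝ, E4) : M → Type)}

/-! ### The tetrad in a chart -/

section Chart

variable (F : SpinFrame g U) (x₀ : M) {y : E4}

/-- The tetrad in the chart at `x₀`. -/
def chartFrame (μ : Fin 4) (y : E4) : E4 :=
  VectorField.mpullback 𝓘(ℝ, E4) 𝓘(ℝ, E4) (extChartAt 𝓘(ℝ, E4) x₀).symm (F.e μ) y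

variable {x₀}

lemma contMDiffAt_chart_symm (hy : y ∈ (extChartAt 𝓘(ℝ, E4) x₀).target) :
    ContMDiffAt 𝓘(ℝ, E4) 𝓘(ℝ, E4) ∞ (extChartAt 𝓘(ℝ, E4) x₀).symm y :=
  (contMDiffOn_extChartAt_symm x₀).contMDiffAt ((isOpen_extChartAt_target x₀).mem_nhds hy)

lemma isInvertible_mfderiv_chart_symm (hy : y ∈ (extChartAt 𝓘(ℝ, E4) x₀).target) :
    (mfderiv 𝓘(ℝ, E4) 𝓘(ℝ, E4) (extChartAt 𝓘(ℝ, E4) x₀).symm y).IsInvertible := by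
  have := isInvertible_mfderivWithin_extChartAt_symm (I := 𝓘(ℝ, E4)) hy
  rwa [ModelWithCorners.Boundaryless.range_eq_univ, mfderivWithin_univ] at this

lemma contDiffAt_chartFrame (hU : IsOpen U) (hy : y ∈ chartDomain U x₀) (μ : Fin 4) :
    ContDiffAt ℝ ∞ (chartFrame F x₀ μ) y := by
  have := ContMDiffAt.mpullback_vectorField_preimage (m := ∞) (n := ∞)
    (F.contMDiffAt hU hy.2 μ) (contMDiffAt_chart_symm hy.1)
    (isInvertible_mfderiv_chart_symm hy.1) (by simp)
  exact contMDiffAt_vectorSpace_iff_contDiffAt.1 this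

lemma mfderiv_chartFrame (hy : y ∈ chartDomain U x₀) (μ : Fin 4) :
    mfderiv 𝓘(ℝ, E4) 𝓘(ℝ, E4) (extChartAt 𝓘(ℝ, E4) x₀).symm y (chartFrame F x₀ μ y)
      = F.e μ ((extChartAt 𝓘(ℝ, E4) x₀).symm y) :=
  (isInvertible_mfderiv_chart_symm hy.1).self_apply_inverse _

/-- Lie brackets are natural under pullback by the inverse chart. -/
lemma mfderiv_lieBracket_chartFrame (hU : IsOpen U) (hy : y ∈ chartDomain U x₀) (μ ν : Fin 4) :
    mfderiv 𝓘(ℝ, E4) 𝓘(ℝ, E4) (extChartAt 𝓘(ℝ, E4) x₀).symm y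
        (VectorField.lieBracket ℝ (chartFrame F x₀ μ) (chartFrame F x₀ ν) y)
      = VectorField.mlieBracket 𝓘(ℝ, E4) (F.e μ) (F.e ν) ((extChartAt 𝓘(ℝ, E4) x₀).symm y) := by
  have hn : minSmoothness ℝ 2 ≤ (∞ : WithTop ℕ∞) := by
    rw [minSmoothness_of_isRCLikeNormedField]
    exact WithTop.coe_le_coe.2 le_top
  have : IsManifold 𝓘(ℝ, E4) (minSmoothness ℝ 2) M :=
    IsManifold.of_le (n := ∞) hn
  have h := VectorField.mpullback_mlieBracket (n := ∞) (F.mdifferentiableAt hU hy.2 μ)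
    (F.mdifferentiableAt hU hy.2 ν) (contMDiffAt_chart_symm hy.1) hn
  rw [← VectorField.mlieBracketWithin_univ (I := 𝓘(ℝ, E4)) (M := E4),
    VectorField.mlieBracketWithin_eq_lieBracketWithin] at h
  refine Eq.trans (congrArg _ (h.trans
    (congrFun (VectorField.lieBracketWithin_univ (𝕜 := ℝ)) y)).symm) ?_
  exact (isInvertible_mfderiv_chart_symm hy.1).self_apply_inverse _

lemma mvfderiv_eq_fderiv_chart {V : Type*} [NormedAddCommGroup V] [NormedSpace ℝ V] {f : M → V}
    (hy : y ∈ (extChartAt 𝓘(ℝ, E4) x₀).target)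
    (hf : MDifferentiableAt 𝓘(ℝ, E4) 𝓘(ℝ, V) f ((extChartAt 𝓘(ℝ, E4) x₀).symm y)) (v : E4) :
    fderiv ℝ (fun z ↦ f ((extChartAt 𝓘(ℝ, E4) x₀).symm z)) y v
      = mvfderiv 𝓘(ℝ, E4) f ((extChartAt 𝓘(ℝ, E4) x₀).symm y)
        (mfderiv 𝓘(ℝ, E4) 𝓘(ℝ, E4) (extChartAt 𝓘(ℝ, E4) x₀).symm y v) := by
  have := (hf.hasMFDerivAt.comp y
    ((contMDiffAt_chart_symm hy).mdifferentiableAt (by simp)).hasMFDerivAt).mfderiv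
  rw [mfderiv_eq_fderiv] at this
  exact DFunLike.congr_fun this v

lemma mvfderiv_tetrad (hy : y ∈ chartDomain U x₀) {V : Type*} [NormedAddCommGroup V]
    [NormedSpace ℝ V] {f : M → V}
    (hf : MDifferentiableAt 𝓘(ℝ, E4) 𝓘(ℝ, V) f ((extChartAt 𝓘(ℝ, E4) x₀).symm y)) (μ : Fin 4) :
    fderiv ℝ (fun z ↦ f ((extChartAt 𝓘(ℝ, E4) x₀).symm z)) y (chartFrame F x₀ μ y)
      = mvfderiv 𝓘(ℝ, E4) f ((extChartAt 𝓘(ℝ, E4) x₀).symm y)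
        (F.e μ ((extChartAt 𝓘(ℝ, E4) x₀).symm y)) := by
  rw [mvfderiv_eq_fderiv_chart hy.1 hf, mfderiv_chartFrame F hy]

/-- Pairing a linear relation with e_ν isolates ±c_ν. -/
lemma linearIndependent_tetrad {x : M} (hx : x ∈ U) :
    LinearIndependent ℝ fun μ ↦ F.e μ x := by
  rw [Fintype.linearIndependent_iff]
  intro c hc ν
  have h := congrArg (fun v ↦ g.inner x v (F.e ν x)) hc
  simp only [map_sum, map_smul, sum_apply, smul_apply,
    F.orthonormal x hx, map_zero, zero_apply, minkowski, smul_eq_mul] at h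
  rw [Finset.sum_eq_single ν (by intro b _ hb; simp [hb]) (by simp)] at h
  simp only [if_true] at h
  exact (mul_eq_zero.1 h).resolve_right (by split_ifs <;> norm_num)

lemma linearIndependent_chartFrame (hy : y ∈ chartDomain U x₀) :
    LinearIndependent ℝ fun μ ↦ chartFrame F x₀ μ y := by
  have h := linearIndependent_tetrad F hy.2
  simp only [← mfderiv_chartFrame F hy] at h
  exact LinearIndependent.of_comp
    (mfderiv 𝓘(ℝ, E4) 𝓘(ℝ, E4) (extChartAt 𝓘(ℝ, E4) x₀).symm y).toLinearMap h

lemma span_chartFrame (hy : y ∈ chartDomain U x₀) :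
    Submodule.span ℝ (Set.range fun μ ↦ chartFrame F x₀ μ y) = ⊤ :=
  (linearIndependent_chartFrame F hy).span_eq_top_of_card_eq_finrank (by simp)

lemma clm_ext_chartFrame (hy : y ∈ chartDomain U x₀) {V : Type*} [AddCommGroup V] [Module ℝ V]
    [TopologicalSpace V] {k l : E4 →L[ℝ] V}
    (h : ∀ μ, k (chartFrame F x₀ μ y) = l (chartFrame F x₀ μ y)) : k = l := by
  apply ContinuousLinearMap.coe_injective
  exact LinearMap.ext_on_range (span_chartFrame F hy) h

end Chart

/-! ### Components of covectors in the orthonormal and in the null tetrad -/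

section Components

lemma ofReal_sqrt_two_sq : ((Real.sqrt 2 : ℝ) : ℂ) ^ 2 = 2 := by
  rw [← Complex.ofReal_pow, Real.sq_sqrt zero_le_two, Complex.ofReal_ofNat]

lemma ofReal_sqrt_two_ne_zero : ((Real.sqrt 2 : ℝ) : ℂ) ≠ 0 := by
  simp

/-- The four matrices are orthonormal for the form tr(AB). This inverts the passage from the
orthonormal to the null tetrad. -/
lemma sum_infeld_swap_mul_infeld (μ ν : Fin 4) :
    ∑ a : Idx, infeld a.swap ν * infeld a μ = if μ = ν then 1 else 0 := by
  have h := ofReal_sqrt_two_sq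
  have h0 := ofReal_sqrt_two_ne_zero
  fin_cases μ <;> fin_cases ν <;>
    simp [infeld, Fintype.sum_prod_type, Fin.sum_univ_two] <;> field_simp <;> simp [h] <;> ring

lemma eq_zero_of_sum_infeld_mul {k : Fin 4 → ℂ} (h : ∀ a, ∑ μ, infeld a μ * k μ = 0)
    (ν : Fin 4) : k ν = 0 := by
  have h1 : ∑ a : Idx, infeld a.swap ν * ∑ μ, infeld a μ * k μ = 0 := by simp [h]
  simp only [Finset.mul_sum] at h1
  rw [Finset.sum_comm] at h1
  simpa only [← mul_assoc, ← Finset.sum_mul, sum_infeld_swap_mul_infeld, ite_mul, one_mul,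
    zero_mul, Finset.sum_ite_eq', Finset.mem_univ, if_true] using h1

/-- The component of a covector along the contravariant orthonormal tetrad. -/
def upperComp (S : Idx → ℂ) (μ : Fin 4) : ℂ := ∑ c, ∑ d, met c d * S c * infeld d μ

/-- The components of a covector in the orthonormal tetrad, from those in the null tetrad. -/
def frameComp (S : Idx → ℂ) (μ : Fin 4) : ℂ := minkowski μ μ * upperComp S μ

lemma sum_infeld_mul_frameComp (S : Idx → ℂ) (a : Idx) :
    ∑ μ, infeld a μ * frameComp S μ = S a := by
  have h := ofReal_sqrt_two_sq
  have h0 := ofReal_sqrt_two_ne_zero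
  have hI := Complex.I_sq
  obtain ⟨A, B⟩ := a
  fin_cases A <;> fin_cases B <;>
    simp [infeld, frameComp, upperComp, met, minkowski, Fintype.sum_prod_type, Fin.sum_univ_two,
      Fin.sum_univ_four] <;> field_simp <;> simp [h, hI] <;> ring

end Components

section SmoothComponents

variable {M : Type*} [TopologicalSpace M] [ChartedSpace E4 M] {U : Set M} (S : M → Idx → ℂ)

lemma contMDiffOn_frameComp (hS : ∀ a, ContMDiffOn 𝓘(ℝ, E4) 𝓘(ℝ, ℂ) ∞ (fun x ↦ S x a) U)
    (μ : Fin 4) : ContMDiffOn 𝓘(ℝ, E4) 𝓘(ℝ, ℂ) ∞ (fun x ↦ frameComp (S x) μ) U := by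
  simp only [frameComp, upperComp]
  refine contMDiffOn_complex_mul contMDiffOn_const
    (contMDiffOn_finsetSum fun c _ ↦ contMDiffOn_finsetSum fun d _ ↦ ?_)
  exact contMDiffOn_complex_mul (contMDiffOn_complex_mul contMDiffOn_const (hS c))
    contMDiffOn_const

end SmoothComponents

/-! ### Covectors as one-forms in a chart -/

section OneForm

variable (F : SpinFrame g U) (S : M → Idx → ℂ) (x₀ : M) {y : E4}

/-- The one-form with components `S` in the null tetrad. -/
def oneForm (x : M) : TangentSpace 𝓘(ℝ, E4) x →L[ℝ] ℂ :=
  ∑ ρ, (g.inner x (F.e ρ x)).smulRight (upperComp (S x) ρ)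

lemma oneForm_apply (x : M) (v : TangentSpace 𝓘(ℝ, E4) x) :
    oneForm F S x v = ∑ ρ, (g.inner x (F.e ρ x) v : ℂ) * upperComp (S x) ρ := by
  simp [oneForm]

lemma oneForm_tetrad {x : M} (hx : x ∈ U) (μ : Fin 4) :
    oneForm F S x (F.e μ x) = frameComp (S x) μ := by
  rw [oneForm_apply, frameComp, Finset.sum_eq_single μ (fun ρ _ h ↦ by
    simp [F.orthonormal x hx, minkowski, h]) (by simp), F.orthonormal x hx]

/-- The one-form with components `S`, in the chart at `x₀`. -/
def chartForm (y : E4) : E4 →L[ℝ] ℂ :=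
  (oneForm F S ((extChartAt 𝓘(ℝ, E4) x₀).symm y)).comp
    (mfderiv 𝓘(ℝ, E4) 𝓘(ℝ, E4) (extChartAt 𝓘(ℝ, E4) x₀).symm y)

variable {x₀}

lemma chartForm_chartFrame (hy : y ∈ chartDomain U x₀) (μ : Fin 4) :
    chartForm F S x₀ y (chartFrame F x₀ μ y)
      = frameComp (S ((extChartAt 𝓘(ℝ, E4) x₀).symm y)) μ := by
  rw [← oneForm_tetrad F S hy.2, ← mfderiv_chartFrame F hy]
  rfl

lemma contDiffAt_chart_comp {V : Type*} [NormedAddCommGroup V] [NormedSpace ℝ V] {f : M → V}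
    (hU : IsOpen U) (hf : ContMDiffOn 𝓘(ℝ, E4) 𝓘(ℝ, V) ∞ f U) (hy : y ∈ chartDomain U x₀) :
    ContDiffAt ℝ ∞ (fun z ↦ f ((extChartAt 𝓘(ℝ, E4) x₀).symm z)) y :=
  contMDiffAt_iff_contDiffAt.1
    ((hf.contMDiffAt (hU.mem_nhds hy.2)).comp y (contMDiffAt_chart_symm hy.1))

/-- Only the values on the tetrad are known to be smooth. With `A` sending the standard basis to the
tetrad and `w` to those values, the form is `w` composed with the inverse of `A`, and inversion of
operators is smooth. -/
lemma contDiffAt_chartForm (hU : IsOpen U)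
    (hS : ∀ a, ContMDiffOn 𝓘(ℝ, E4) 𝓘(ℝ, ℂ) ∞ (fun x ↦ S x a) U) (hy : y ∈ chartDomain U x₀) :
    ContDiffAt ℝ ∞ (chartForm F S x₀) y := by
  let A (z : E4) : (Fin 4 → ℝ) →L[ℝ] E4 :=
    ∑ μ, (ContinuousLinearMap.proj (R := ℝ) (φ := fun _ : Fin 4 ↦ ℝ) μ).smulRight
      (chartFrame F x₀ μ z)
  let w (z : E4) : (Fin 4 → ℝ) →L[ℝ] ℂ :=
    ∑ μ, (ContinuousLinearMap.proj (R := ℝ) (φ := fun _ : Fin 4 ↦ ℝ) μ).smulRight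
      (frameComp (S ((extChartAt 𝓘(ℝ, E4) x₀).symm z)) μ)
  have hA : ContDiffAt ℝ ∞ A y := ContDiffAt.sum fun μ _ ↦
    contDiffAt_const.smulRight (contDiffAt_chartFrame F hU hy μ)
  have hw : ContDiffAt ℝ ∞ w y := ContDiffAt.sum fun μ _ ↦
    contDiffAt_const.smulRight (contDiffAt_chart_comp hU (contMDiffOn_frameComp S hS μ) hy)
  have hAinv : ∀ z ∈ chartDomain U x₀, (A z).IsInvertible := fun z hz ↦ by
    let b := basisOfLinearIndependentOfCardEqFinrank (linearIndependent_chartFrame F hz) (by simp)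
    refine ⟨b.equivFun.symm.toContinuousLinearEquiv, ?_⟩
    ext c
    simp [A, b, Module.Basis.equivFun_symm_apply]
  have hAs : ∀ z μ, A z (Pi.single μ 1) = chartFrame F x₀ μ z := fun z μ ↦ by
    simp [A, Pi.single_apply]
  have h : ∀ z ∈ chartDomain U x₀, chartForm F S x₀ z = (w z).comp (A z).inverse := fun z hz ↦ by
    refine clm_ext_chartFrame F hz fun μ ↦ ?_
    rw [chartForm_chartFrame F S hz, ContinuousLinearMap.comp_apply]
    conv_rhs => rw [← hAs z μ, (hAinv z hz).inverse_apply_self]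
    simp [w, Pi.single_apply]
  refine ContDiffAt.congr_of_eventuallyEq (hw.clm_comp ?_)
    (Filter.eventually_of_mem ((isOpen_chartDomain x₀ hU).mem_nhds hy) h)
  exact (hAinv y hy).contDiffAt_map_inverse.comp y hA

/-- Leibniz rule for the component θ(e_ν). After antisymmetrisation the derivatives of the tetrad
form a Lie bracket. -/
lemma fderiv_chartForm (hU : IsOpen U)
    (hS : ∀ a, ContMDiffOn 𝓘(ℝ, E4) 𝓘(ℝ, ℂ) ∞ (fun x ↦ S x a) U) (hy : y ∈ chartDomain U x₀)
    (μ ν : Fin 4) :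
    fderiv ℝ (chartForm F S x₀) y (chartFrame F x₀ μ y) (chartFrame F x₀ ν y)
      = mvfderiv 𝓘(ℝ, E4) (fun x ↦ frameComp (S x) ν) ((extChartAt 𝓘(ℝ, E4) x₀).symm y)
          (F.e μ ((extChartAt 𝓘(ℝ, E4) x₀).symm y))
        - chartForm F S x₀ y (fderiv ℝ (chartFrame F x₀ ν) y (chartFrame F x₀ μ y)) := by
  have h1 := (contDiffAt_chartForm F S hU hS hy).differentiableAt (by simp)
  have h2 := (contDiffAt_chartFrame F hU hy ν).differentiableAt (by simp)
  rw [← mvfderiv_tetrad F hy (((contMDiffOn_frameComp S hS ν).contMDiffAt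
    (hU.mem_nhds hy.2)).mdifferentiableAt (by simp))]
  have h3 : (fun z ↦ frameComp (S ((extChartAt 𝓘(ℝ, E4) x₀).symm z)) ν)
      =ᶠ[nhds y] fun z ↦ chartForm F S x₀ z (chartFrame F x₀ ν z) :=
    Filter.eventually_of_mem ((isOpen_chartDomain x₀ hU).mem_nhds hy)
      fun z hz ↦ (chartForm_chartFrame F S hz ν).symm
  rw [h3.fderiv_eq, fderiv_clm_apply h1 h2]
  simp

/-- The exterior derivative of `chartForm`, on the tetrad. -/
lemma fderiv_chartForm_sub (hU : IsOpen U)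
    (hS : ∀ a, ContMDiffOn 𝓘(ℝ, E4) 𝓘(ℝ, ℂ) ∞ (fun x ↦ S x a) U) (hy : y ∈ chartDomain U x₀)
    (μ ν : Fin 4) :
    fderiv ℝ (chartForm F S x₀) y (chartFrame F x₀ μ y) (chartFrame F x₀ ν y)
        - fderiv ℝ (chartForm F S x₀) y (chartFrame F x₀ ν y) (chartFrame F x₀ μ y)
      = mvfderiv 𝓘(ℝ, E4) (fun x ↦ frameComp (S x) ν) ((extChartAt 𝓘(ℝ, E4) x₀).symm y)
          (F.e μ ((extChartAt 𝓘(ℝ, E4) x₀).symm y))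
        - mvfderiv 𝓘(ℝ, E4) (fun x ↦ frameComp (S x) μ) ((extChartAt 𝓘(ℝ, E4) x₀).symm y)
          (F.e ν ((extChartAt 𝓘(ℝ, E4) x₀).symm y))
        - oneForm F S ((extChartAt 𝓘(ℝ, E4) x₀).symm y)
          (VectorField.mlieBracket 𝓘(ℝ, E4) (F.e μ) (F.e ν)
            ((extChartAt 𝓘(ℝ, E4) x₀).symm y)) := by
  rw [← mfderiv_lieBracket_chartFrame F hU hy]
  have : oneForm F S ((extChartAt 𝓘(ℝ, E4) x₀).symm y)
      (mfderiv 𝓘(ℝ, E4) 𝓘(ℝ, E4) (extChartAt 𝓘(ℝ, E4) x₀).symm y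
        (VectorField.lieBracket ℝ (chartFrame F x₀ μ) (chartFrame F x₀ ν) y))
      = chartForm F S x₀ y (fderiv ℝ (chartFrame F x₀ ν) y (chartFrame F x₀ μ y))
        - chartForm F S x₀ y (fderiv ℝ (chartFrame F x₀ μ) y (chartFrame F x₀ ν y)) := by
    rw [← map_sub]
    rfl
  rw [this, fderiv_chartForm F S hU hS hy, fderiv_chartForm F S hU hS hy]
  ring

end OneForm

end RainichThree

namespace RainichThree

lemma sum_sum_sum_comm {ι κ : Type*} [Fintype ι] [Fintype κ] (f : ι → ι → κ → ℂ) :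
    ∑ c, ∑ d, ∑ μ, f c d μ = ∑ μ, ∑ c, ∑ d, f c d μ :=
  (Finset.sum_congr rfl fun _ _ ↦ Finset.sum_comm).trans Finset.sum_comm

section ChartDomain

variable {M : Type*} [TopologicalSpace M] [ChartedSpace E4 M] {U : Set M} {x₀ x : M}

lemma map_mem_chartDomain (hx : x ∈ U) (hx' : x ∈ (extChartAt 𝓘(ℝ, E4) x₀).source) :
    extChartAt 𝓘(ℝ, E4) x₀ x ∈ chartDomain U x₀ :=
  ⟨(extChartAt 𝓘(ℝ, E4) x₀).map_source hx', by
    rwa [Set.mem_preimage, (extChartAt 𝓘(ℝ, E4) x₀).left_inv hx']⟩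

lemma eventually_mem_chart_source (hU : IsOpen U) (hx : x ∈ U) :
    ∀ᶠ y in nhds x, y ∈ U ∧ y ∈ (extChartAt 𝓘(ℝ, E4) x).source :=
  Filter.Eventually.and (hU.mem_nhds hx) (extChartAt_source_mem_nhds x)

end ChartDomain

variable {M : Type*} [TopologicalSpace M] [ChartedSpace E4 M] [IsManifold 𝓘(ℝ, E4) ∞ M]
  {g : LorentzMetric M} {U : Set M}
  {cov : CovariantDerivative 𝓘(ℝ, E4) E4 (TangentSpace 𝓘(ℝ, E4) : M → Type)}

/-! ### The curl of a covector field -/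

section Curl

variable {F : SpinFrame g U} {S : M → Idx → ℂ} {x₀ x : M}

variable (cov F S) in
/-- `∇_a S_b - ∇_b S_a`. -/
def curl (x : M) (a b : Idx) : ℂ := nablaCovector cov F S x a b - nablaCovector cov F S x b a

lemma frameDeriv_eq_sum_frameComp
    (hS : ∀ a, MDifferentiableAt 𝓘(ℝ, E4) 𝓘(ℝ, ℂ) (fun y ↦ S y a) x) (a b : Idx) :
    frameDeriv F a (fun y ↦ S y b) x
      = ∑ μ, ∑ ν, infeld a μ * infeld b ν *
        mvfderiv 𝓘(ℝ, E4) (fun y ↦ frameComp (S y) ν) x (F.e μ x) := by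
  have h1 : ∀ ν, MDifferentiableAt 𝓘(ℝ, E4) 𝓘(ℝ, ℂ) (fun y ↦ frameComp (S y) ν) x := fun ν ↦
    (((HasFrameDeriv.sum Finset.univ fun c _ ↦ HasFrameDeriv.sum Finset.univ fun d _ ↦
      (((hasFrameDeriv_const (met c d)).mul (hasFrameDeriv_frameDeriv (F := F) (d := a) (hS c))).mul
        (hasFrameDeriv_const (infeld d ν))))).const_mul (minkowski ν ν)).1
  have h2 := HasFrameDeriv.sum Finset.univ fun ν _ ↦
    (hasFrameDeriv_frameDeriv (F := F) (d := a) (h1 ν)).const_mul (infeld b ν)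
  simp only [sum_infeld_mul_frameComp] at h2
  rw [h2.2, Finset.sum_comm]
  simp only [frameDeriv, Finset.mul_sum]
  refine Finset.sum_congr rfl fun ν _ ↦ Finset.sum_congr rfl fun μ _ ↦ ?_
  ring

lemma sum_connUp_mul (a b : Idx) :
    ∑ c, connUp cov F x a b c * S x c
      = ∑ μ, ∑ ν, infeld a μ * infeld b ν * oneForm F S x (cov (F.e ν) x (F.e μ x)) := by
  simp only [connUp, conn, oneForm_apply, upperComp, Finset.mul_sum, Finset.sum_mul]
  simp only [sum_sum_sum_comm (κ := Fin 4) (ι := Idx)]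
  refine Finset.sum_congr rfl fun μ _ ↦ Finset.sum_congr rfl fun ν _ ↦ Finset.sum_congr rfl
    fun ρ _ ↦ Finset.sum_congr rfl fun c _ ↦ Finset.sum_congr rfl fun d _ ↦ ?_
  rw [g.symm x (F.e ρ x)]
  ring

/-- Cartan's formula dS(X, Y) = X(S(Y)) - Y(S(X)) - S([X, Y]): vanishing torsion merges the
connection terms into the bracket. -/
lemma curl_eq (hcov : IsLeviCivita g cov) (hU : IsOpen U) (hx : x ∈ U)
    (hS : ∀ a, MDifferentiableAt 𝓘(ℝ, E4) 𝓘(ℝ, ℂ) (fun y ↦ S y a) x) (a b : Idx) :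
    curl cov F S x a b = ∑ μ, ∑ ν, infeld a μ * infeld b ν *
      (mvfderiv 𝓘(ℝ, E4) (fun y ↦ frameComp (S y) ν) x (F.e μ x)
        - mvfderiv 𝓘(ℝ, E4) (fun y ↦ frameComp (S y) μ) x (F.e ν x)
        - oneForm F S x (VectorField.mlieBracket 𝓘(ℝ, E4) (F.e μ) (F.e ν) x)) := by
  have ht : ∀ μ ν, VectorField.mlieBracket 𝓘(ℝ, E4) (F.e μ) (F.e ν) x
      = cov (F.e ν) x (F.e μ x) - cov (F.e μ) x (F.e ν x) := fun μ ν ↦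
    (cov.torsion_eq_zero_iff.1 hcov.torsion_free (F.mdifferentiableAt hU hx μ)
      (F.mdifferentiableAt hU hx ν)).symm
  simp only [curl, nablaCovector, sum_connUp_mul, frameDeriv_eq_sum_frameComp hS, ht, map_sub]
  rw [Finset.sum_comm (f := fun μ ν ↦ infeld b μ * infeld a ν *
      mvfderiv 𝓘(ℝ, E4) (fun y ↦ frameComp (S y) ν) x (F.e μ x)),
    Finset.sum_comm (f := fun μ ν ↦ infeld b μ * infeld a ν *
      oneForm F S x (cov (F.e ν) x (F.e μ x)))]
  simp only [← Finset.sum_sub_distrib]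
  refine Finset.sum_congr rfl fun μ _ ↦ Finset.sum_congr rfl fun ν _ ↦ ?_
  ring

end Curl

/-! ### Gradients and local primitives -/

section Primitive

variable {F : SpinFrame g U} {S : M → Idx → ℂ} {x₀ x : M} {f : M → ℂ}

lemma frameComp_frameDeriv (μ : Fin 4) :
    frameComp (fun a ↦ frameDeriv F a f x) μ = mvfderiv 𝓘(ℝ, E4) f x (F.e μ x) := by
  refine sub_eq_zero.1 (eq_zero_of_sum_infeld_mul (k := fun μ ↦
    frameComp (fun a ↦ frameDeriv F a f x) μ - mvfderiv 𝓘(ℝ, E4) f x (F.e μ x)) (fun a ↦ ?_) μ)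
  simp only [mul_sub, Finset.sum_sub_distrib, sum_infeld_mul_frameComp]
  exact sub_self _

/-- Smoothness is read off in a chart, where this is an ordinary derivative applied to the chart
tetrad. -/
lemma contMDiffOn_mvfderiv_tetrad (hU : IsOpen U) (hf : ContMDiffOn 𝓘(ℝ, E4) 𝓘(ℝ, ℂ) ∞ f U)
    (μ : Fin 4) :
    ContMDiffOn 𝓘(ℝ, E4) 𝓘(ℝ, ℂ) ∞ (fun x ↦ mvfderiv 𝓘(ℝ, E4) f x (F.e μ x)) U := by
  intro x hx
  refine ContMDiffAt.contMDiffWithinAt ?_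
  have hy := map_mem_chartDomain hx (mem_extChartAt_source (I := 𝓘(ℝ, E4)) x)
  have h1 : ContDiffAt ℝ ∞ (fun y ↦ fderiv ℝ (fun z ↦ f ((extChartAt 𝓘(ℝ, E4) x).symm z)) y
      (chartFrame F x μ y)) (extChartAt 𝓘(ℝ, E4) x x) :=
    ((contDiffAt_chart_comp hU hf hy).fderiv_right (m := ∞) (by simp)).clm_apply
      (contDiffAt_chartFrame F hU hy μ)
  refine (h1.contMDiffAt.comp x (contMDiffAt_extChartAt (n := ∞))).congr_of_eventuallyEq ?_
  filter_upwards [eventually_mem_chart_source hU hx] with y hy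
  have hy' := map_mem_chartDomain hy.1 hy.2
  have hψ := (extChartAt 𝓘(ℝ, E4) x).left_inv hy.2
  have h2 := mvfderiv_tetrad F hy' (f := f) (by
    rw [hψ]
    exact (hf.contMDiffAt (hU.mem_nhds hy.1)).mdifferentiableAt (by simp)) μ
  rw [Function.comp_apply, h2, hψ]

lemma contMDiffOn_frameDeriv (hU : IsOpen U) (hf : ContMDiffOn 𝓘(ℝ, E4) 𝓘(ℝ, ℂ) ∞ f U) (a : Idx) :
    ContMDiffOn 𝓘(ℝ, E4) 𝓘(ℝ, ℂ) ∞ (frameDeriv F a f) U :=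
  contMDiffOn_finsetSum fun μ _ ↦
    contMDiffOn_complex_mul contMDiffOn_const (contMDiffOn_mvfderiv_tetrad hU hf μ)

lemma chartForm_frameDeriv (hU : IsOpen U) (hf : ContMDiffOn 𝓘(ℝ, E4) 𝓘(ℝ, ℂ) ∞ f U)
    (hS : ∀ x ∈ U, ∀ a, S x a = frameDeriv F a f x) {y : E4} (hy : y ∈ chartDomain U x₀) :
    chartForm F S x₀ y = fderiv ℝ (fun z ↦ f ((extChartAt 𝓘(ℝ, E4) x₀).symm z)) y := by
  refine clm_ext_chartFrame F hy fun μ ↦ ?_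
  rw [chartForm_chartFrame F S hy, mvfderiv_tetrad F hy
    ((hf.contMDiffAt (hU.mem_nhds hy.2)).mdifferentiableAt (by simp)), ← frameComp_frameDeriv]
  exact congrArg (fun s ↦ frameComp s μ) (funext (hS _ hy.2))

/-- The exterior derivative of the one-form at a point, in terms of the curl. -/
lemma curl_eq_sum_fderiv_chartForm (hcov : IsLeviCivita g cov) (hU : IsOpen U)
    (hS : ∀ a, ContMDiffOn 𝓘(ℝ, E4) 𝓘(ℝ, ℂ) ∞ (fun x ↦ S x a) U) {y : E4}
    (hy : y ∈ chartDomain U x₀) (a b : Idx) :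
    curl cov F S ((extChartAt 𝓘(ℝ, E4) x₀).symm y) a b = ∑ μ, ∑ ν, infeld a μ * infeld b ν *
      (fderiv ℝ (chartForm F S x₀) y (chartFrame F x₀ μ y) (chartFrame F x₀ ν y)
        - fderiv ℝ (chartForm F S x₀) y (chartFrame F x₀ ν y) (chartFrame F x₀ μ y)) := by
  rw [curl_eq hcov hU hy.2 fun a ↦
    ((hS a).contMDiffAt (hU.mem_nhds hy.2)).mdifferentiableAt (by simp)]
  simp only [fderiv_chartForm_sub F S hU hS hy]

/-- A gradient has no curl. -/
lemma curl_frameDeriv (hcov : IsLeviCivita g cov) (hU : IsOpen U)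
    (hf : ContMDiffOn 𝓘(ℝ, E4) 𝓘(ℝ, ℂ) ∞ f U) (hS : ∀ x ∈ U, ∀ a, S x a = frameDeriv F a f x)
    (hx : x ∈ U) (a b : Idx) : curl cov F S x a b = 0 := by
  have hS' : ∀ a, ContMDiffOn 𝓘(ℝ, E4) 𝓘(ℝ, ℂ) ∞ (fun x ↦ S x a) U := fun a ↦
    (contMDiffOn_frameDeriv hU hf a).congr fun x hx ↦ hS x hx a
  have hy := map_mem_chartDomain hx (mem_extChartAt_source (I := 𝓘(ℝ, E4)) x)
  have h := curl_eq_sum_fderiv_chartForm (F := F) hcov hU hS' hy a b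
  rw [(extChartAt 𝓘(ℝ, E4) x).left_inv (mem_extChartAt_source x)] at h
  rw [h]
  have h1 : chartForm F S x =ᶠ[nhds (extChartAt 𝓘(ℝ, E4) x x)]
      fderiv ℝ fun z ↦ f ((extChartAt 𝓘(ℝ, E4) x).symm z) :=
    Filter.eventually_of_mem ((isOpen_chartDomain x hU).mem_nhds hy)
      fun z hz ↦ chartForm_frameDeriv hU hf hS hz
  have h2 : IsSymmSndFDerivAt ℝ (fun z ↦ f ((extChartAt 𝓘(ℝ, E4) x).symm z))
      (extChartAt 𝓘(ℝ, E4) x x) :=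
    (contDiffAt_chart_comp hU hf hy).isSymmSndFDerivAt (by
      rw [minSmoothness_of_isRCLikeNormedField]
      exact WithTop.coe_le_coe.2 le_top)
  rw [h1.fderiv_eq]
  refine Finset.sum_eq_zero fun μ _ ↦ Finset.sum_eq_zero fun ν _ ↦ ?_
  rw [h2.eq, sub_self, mul_zero]

/-- The Infeld symbols are invertible and the tetrad spans, so vanishing null components of the curl
force symmetry on all vectors. -/
lemma fderiv_chartForm_symm (hcov : IsLeviCivita g cov) (hU : IsOpen U)
    (hS : ∀ a, ContMDiffOn 𝓘(ℝ, E4) 𝓘(ℝ, ℂ) ∞ (fun x ↦ S x a) U)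
    (hcurl : ∀ x ∈ U, ∀ a b, curl cov F S x a b = 0) {y : E4} (hy : y ∈ chartDomain U x₀)
    (v w : E4) :
    fderiv ℝ (chartForm F S x₀) y v w = fderiv ℝ (chartForm F S x₀) y w v := by
  have h1 : ∀ μ ν, fderiv ℝ (chartForm F S x₀) y (chartFrame F x₀ μ y) (chartFrame F x₀ ν y)
      = fderiv ℝ (chartForm F S x₀) y (chartFrame F x₀ ν y) (chartFrame F x₀ μ y) := by
    intro μ ν
    have h2 : ∀ a b, ∑ μ, infeld a μ * ∑ ν, infeld b ν *
        (fderiv ℝ (chartForm F S x₀) y (chartFrame F x₀ μ y) (chartFrame F x₀ ν y)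
        - fderiv ℝ (chartForm F S x₀) y (chartFrame F x₀ ν y) (chartFrame F x₀ μ y)) = 0 := by
      intro a b
      rw [← hcurl _ hy.2 a b, curl_eq_sum_fderiv_chartForm hcov hU hS hy]
      simp only [Finset.mul_sum, mul_assoc]
    exact sub_eq_zero.1 (eq_zero_of_sum_infeld_mul
      (fun b ↦ eq_zero_of_sum_infeld_mul (fun a ↦ h2 a b) μ) ν)
  have h3 : fderiv ℝ (chartForm F S x₀) y = (fderiv ℝ (chartForm F S x₀) y).flip :=
    clm_ext_chartFrame F hy fun μ ↦ clm_ext_chartFrame F hy fun ν ↦ by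
      rw [ContinuousLinearMap.flip_apply, h1]
  conv_lhs => rw [h3]
  rfl

/-- The Poincaré lemma: a smooth covector field without curl is locally a gradient. -/
lemma exists_local_primitive (hcov : IsLeviCivita g cov) (hU : IsOpen U)
    (hS : ∀ a, ContMDiffOn 𝓘(ℝ, E4) 𝓘(ℝ, ℂ) ∞ (fun x ↦ S x a) U)
    (hcurl : ∀ x ∈ U, ∀ a b, curl cov F S x a b = 0) (hx : x ∈ U) :
    ∃ V : Set M, IsOpen V ∧ x ∈ V ∧ V ⊆ U ∧ ∃ f : M → ℂ,
      ContMDiffOn 𝓘(ℝ, E4) 𝓘(ℝ, ℂ) ∞ f V ∧ ∀ y ∈ V, ∀ a, frameDeriv F a f y = S y a := by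
  have hy := map_mem_chartDomain hx (mem_extChartAt_source (I := 𝓘(ℝ, E4)) x)
  -- A ball is convex, as the Poincaré lemma in E4 requires.
  obtain ⟨r, hr, hball⟩ := Metric.isOpen_iff.1 (isOpen_chartDomain x hU) _ hy
  have hsmooth : ContDiffOn ℝ ∞ (chartForm F S x) (Metric.ball (extChartAt 𝓘(ℝ, E4) x x) r) :=
    fun z hz ↦ (contDiffAt_chartForm F S hU hS (hball hz)).contDiffWithinAt
  obtain ⟨k, hk⟩ := (convex_ball (extChartAt 𝓘(ℝ, E4) x x)
    r).exists_forall_hasFDerivAt_of_fderiv_symmetric Metric.isOpen_ball (hsmooth.differentiableOn (by simp))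
    fun z hz v w ↦ fderiv_chartForm_symm hcov hU hS hcurl (hball hz) v w
  have hk' : ContDiffOn ℝ ∞ k (Metric.ball (extChartAt 𝓘(ℝ, E4) x x) r) :=
    (contDiffOn_infty_iff_fderiv_of_isOpen Metric.isOpen_ball).2
      ⟨fun z hz ↦ (hk z hz).differentiableAt.differentiableWithinAt,
        hsmooth.congr fun z hz ↦ (hk z hz).fderiv⟩
  have hV : ∀ z ∈ (extChartAt 𝓘(ℝ, E4) x).source ∩
      extChartAt 𝓘(ℝ, E4) x ⁻¹' Metric.ball (extChartAt 𝓘(ℝ, E4) x x) r, z ∈ U := fun z hz ↦ by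
    have := (hball hz.2).2
    rwa [Set.mem_preimage, (extChartAt 𝓘(ℝ, E4) x).left_inv hz.1] at this
  refine ⟨(extChartAt 𝓘(ℝ, E4) x).source ∩
      extChartAt 𝓘(ℝ, E4) x ⁻¹' Metric.ball (extChartAt 𝓘(ℝ, E4) x x) r,
    (continuousOn_extChartAt x).isOpen_inter_preimage (isOpen_extChartAt_source x)
      Metric.isOpen_ball,
    ⟨mem_extChartAt_source x, Metric.mem_ball_self hr⟩, hV,
    fun z ↦ k (extChartAt 𝓘(ℝ, E4) x z), ?_, fun z hz a ↦ ?_⟩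
  · exact hk'.contMDiffOn.comp ((contMDiffOn_extChartAt (n := ∞)).mono fun z hz ↦ by
      simpa [extChartAt_source] using hz.1) fun z hz ↦ hz.2
  · have hd := (hk _ hz.2)
    have hφ : MDifferentiableAt 𝓘(ℝ, E4) 𝓘(ℝ, E4) (extChartAt 𝓘(ℝ, E4) x) z :=
      mdifferentiableAt_extChartAt (by simpa [extChartAt_source] using hz.1)
    have hψ := (extChartAt 𝓘(ℝ, E4) x).left_inv hz.1
    have hmd := mdifferentiableAt_comp_eq hφ hd
    have h1 : ∀ μ, mvfderiv 𝓘(ℝ, E4) (fun z ↦ k (extChartAt 𝓘(ℝ, E4) x z)) z (F.e μ z)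
        = frameComp (S z) μ := fun μ ↦ by
      have h2 := mvfderiv_tetrad F (hball hz.2) (f := fun z ↦ k (extChartAt 𝓘(ℝ, E4) x z))
        (by rwa [hψ]) μ
      have h3 : (fun z ↦ k (extChartAt 𝓘(ℝ, E4) x ((extChartAt 𝓘(ℝ, E4) x).symm z)))
          =ᶠ[nhds (extChartAt 𝓘(ℝ, E4) x z)] k :=
        Filter.eventually_of_mem ((isOpen_extChartAt_target x).mem_nhds (hball hz.2).1)
          fun w hw ↦ congrArg k ((extChartAt 𝓘(ℝ, E4) x).right_inv hw)
      rw [h3.fderiv_eq, hd.fderiv, chartForm_chartFrame F S (hball hz.2), hψ] at h2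
      exact h2.symm
    simp only [frameDeriv, h1, sum_infeld_mul_frameComp]

/-- A function without gradient is locally constant. -/
lemma eventually_eq_of_frameDeriv_eq_zero {V : Set M} (hV : IsOpen V) (hVU : V ⊆ U)
    (hf : ContMDiffOn 𝓘(ℝ, E4) 𝓘(ℝ, ℂ) ∞ f V) (h0 : ∀ y ∈ V, ∀ a, frameDeriv F a f y = 0)
    (hx : x ∈ V) : ∀ᶠ y in nhds x, f y = f x := by
  have hy := map_mem_chartDomain hx (mem_extChartAt_source (I := 𝓘(ℝ, E4)) x)
  obtain ⟨r, hr, hball⟩ := Metric.isOpen_iff.1 (isOpen_chartDomain x hV) _ hy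
  have hd : ∀ z ∈ Metric.ball (extChartAt 𝓘(ℝ, E4) x x) r,
      DifferentiableAt ℝ (fun z ↦ f ((extChartAt 𝓘(ℝ, E4) x).symm z)) z ∧
        fderiv ℝ (fun z ↦ f ((extChartAt 𝓘(ℝ, E4) x).symm z)) z = 0 := fun z hz ↦ by
    have hzU : z ∈ chartDomain U x := ⟨(hball hz).1, hVU (hball hz).2⟩
    refine ⟨(contDiffAt_chart_comp hV hf (hball hz)).differentiableAt (by simp),
      clm_ext_chartFrame F hzU fun μ ↦ ?_⟩
    rw [mvfderiv_tetrad F hzU ((hf.contMDiffAt (hV.mem_nhds (hball hz).2)).mdifferentiableAt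
      (by simp)), ← frameComp_frameDeriv]
    simp only [h0 _ (hball hz).2, frameComp, upperComp]
    simp
  have hc : ∀ z ∈ Metric.ball (extChartAt 𝓘(ℝ, E4) x x) r,
      f ((extChartAt 𝓘(ℝ, E4) x).symm z) = f x := fun z hz ↦ by
    have := Metric.isOpen_ball.is_const_of_fderiv_eq_zero (𝕜 := ℝ)
      (convex_ball (extChartAt 𝓘(ℝ, E4) x x) r).isPreconnected
      (fun z hz ↦ (hd z hz).1.differentiableWithinAt) (fun z hz ↦ (hd z hz).2) hz
      (Metric.mem_ball_self hr)
    rwa [(extChartAt 𝓘(ℝ, E4) x).left_inv (mem_extChartAt_source x)] at this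
  filter_upwards [extChartAt_source_mem_nhds (I := 𝓘(ℝ, E4)) x,
    (continuousAt_extChartAt (I := 𝓘(ℝ, E4)) x).preimage_mem_nhds (Metric.ball_mem_nhds _ hr)]
    with z hz hz'
  rw [← hc _ hz', (extChartAt 𝓘(ℝ, E4) x).left_inv hz]

end Primitive

end RainichThree

namespace RainichThree

/-! ### Gluing local primitives on simply connected spaces -/

section Gluing

variable {X A : Type*} [TopologicalSpace X] [AddCommGroup A]

/-- The principal bundle with discrete fibre `A` whose sections glue the local functions `f i`,
which differ by locally constant functions on overlaps. -/
def primitiveBundle [TopologicalSpace A] [DiscreteTopology A] (V : X → Set X)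
    (hV : ∀ i, IsOpen (V i)) (hmem : ∀ i, i ∈ V i) (f : X → X → A)
    (hf : ∀ i j, ∀ x ∈ V i ∩ V j, ∀ᶠ y in nhds x, f i y - f j y = f i x - f j x) :
    FiberBundleCore X X A where
  baseSet := V
  isOpen_baseSet := hV
  indexAt := id
  mem_baseSet_at := hmem
  coordChange i j x v := v + (f i x - f j x)
  coordChange_self i x _ v := by simp
  continuousOn_coordChange i j := by
    rintro ⟨x, v⟩ ⟨hx, -⟩
    refine ContinuousAt.continuousWithinAt ?_
    have h : (fun p : X × A ↦ p.2 + (f i p.1 - f j p.1))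
        =ᶠ[nhds (x, v)] fun p ↦ p.2 + (f i x - f j x) := by
      filter_upwards [continuous_fst.continuousAt.eventually (hf i j x hx)] with p hp
      rw [hp]
    refine ContinuousAt.congr ?_ h.symm
    exact ((continuous_of_discreteTopology (f := fun a ↦ a + (f i x - f j x))).comp
      continuous_snd).continuousAt
  coordChange_comp i j k x _ v := by abel

/-- Local functions that differ by locally constant functions on overlaps come, up to local
constants, from one global function, if the space is simply connected. -/
theorem exists_glued_primitive [SimplyConnectedSpace X] [LocallyPathConnectedSpace X]
    (V : X → Set X) (hV : ∀ i, IsOpen (V i)) (hmem : ∀ i, i ∈ V i) (f : X → X → A)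
    (hf : ∀ i j, ∀ x ∈ V i ∩ V j, ∀ᶠ y in nhds x, f i y - f j y = f i x - f j x) :
    ∃ h : X → A, ∀ x, ∃ c, ∀ᶠ y in nhds x, h y = f x y + c := by
  -- With discrete fibre the bundle is a covering. Its transition rule keeps f_i + v_i the same in
  -- every trivialisation.
  let _ : TopologicalSpace A := ⊥
  have : DiscreteTopology A := ⟨rfl⟩
  let Z := primitiveBundle V hV hmem f hf
  have hcov : IsCoveringMap Z.proj := FiberBundle.isCoveringMap (F := A) (E := Z.Fiber)
  obtain ⟨x₀⟩ : Nonempty X := inferInstance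
  -- A lift of the identity is a global section; it exists because `X` is simply connected.
  obtain ⟨s, ⟨-, hs⟩, -⟩ := hcov.existsUnique_continuousMap_lifts (ContinuousMap.id X) x₀
    (⟨x₀, (0 : A)⟩ : Z.TotalSpace) rfl
  have hs' : ∀ x, (s x).1 = x := fun x ↦ congrFun hs x
  -- The fibre over x is read in the trivialisation indexed by x, hence the term f_x(x).
  refine ⟨fun x ↦ (show A from (s x).2) + f x x, fun x ↦
    ⟨(Z.localTriv x (s x)).2, ?_⟩⟩
  have hx : s x ∈ (Z.localTriv x).source := by
    rw [Z.mem_localTriv_source, hs']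
    exact hmem x
  have h1 : ContinuousAt (fun y ↦ (Z.localTriv x (s y)).2) x :=
    (((Z.localTriv x).continuousAt hx).comp s.continuous.continuousAt).snd
  -- A continuous map into a discrete space is locally constant.
  have h2 : ∀ᶠ y in nhds x, (Z.localTriv x (s y)).2 = (Z.localTriv x (s x)).2 :=
    h1.eventually (p := fun a ↦ a = (Z.localTriv x (s x)).2)
      (by rw [nhds_discrete]; exact Filter.mem_pure.2 rfl)
  filter_upwards [h2] with y hy
  rw [← hy, Z.localTriv_apply]
  change (show A from (s y).2) + f y y
    = f x y + ((show A from (s y).2) + (f (s y).1 (s y).1 - f x (s y).1))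
  rw [hs']
  abel

end Gluing

variable {M : Type*} [TopologicalSpace M] [ChartedSpace E4 M] [IsManifold 𝓘(ℝ, E4) ∞ M]
  {g : LorentzMetric M} {U : Set M}
  {cov : CovariantDerivative 𝓘(ℝ, E4) E4 (TangentSpace 𝓘(ℝ, E4) : M → Type)}

section Global

variable {F : SpinFrame g U} {S : M → Idx → ℂ}

/-- A smooth covector field without curl on a simply connected region is a gradient. -/
lemma exists_global_primitive (hcov : IsLeviCivita g cov) (hU : IsOpen U)
    [SimplyConnectedSpace U]
    (hS : ∀ a, ContMDiffOn 𝓘(ℝ, E4) 𝓘(ℝ, ℂ) ∞ (fun x ↦ S x a) U)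
    (hcurl : ∀ x ∈ U, ∀ a b, curl cov F S x a b = 0) :
    ∃ f : M → ℂ, ContMDiffOn 𝓘(ℝ, E4) 𝓘(ℝ, ℂ) ∞ f U ∧
      ∀ y ∈ U, ∀ a, frameDeriv F a f y = S y a := by
  classical
  choose V hV hxV hVU f hf hfS using fun x : U ↦ exists_local_primitive hcov hU hS hcurl x.2
  have : LocallyPathConnectedSpace M := ChartedSpace.locallyPathConnectedSpace E4 M
  have : LocallyPathConnectedSpace U := hU.locallyPathConnectedSpace
  have hfd : ∀ i : U, ∀ y ∈ V i, MDifferentiableAt 𝓘(ℝ, E4) 𝓘(ℝ, ℂ) (f i) y := fun i y hy ↦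
    ((hf i).contMDiffAt ((hV i).mem_nhds hy)).mdifferentiableAt (by simp)
  obtain ⟨h, hh⟩ := exists_glued_primitive (fun i : U ↦ Subtype.val ⁻¹' V i)
    (fun i ↦ (hV i).preimage continuous_subtype_val) hxV (fun i y ↦ f i y) (by
      rintro i j x ⟨hxi, hxj⟩
      -- Two primitives of the same covector differ by a function with zero gradient, hence by a
      -- locally constant one.
      have h0 : ∀ y ∈ V i ∩ V j, ∀ a, frameDeriv F a (fun y ↦ f i y - f j y) y = 0 :=
        fun y hy a ↦ by
          rw [((hasFrameDeriv_frameDeriv (hfd i y hy.1)).sub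
            (hasFrameDeriv_frameDeriv (hfd j y hy.2))).2, hfS i y hy.1, hfS j y hy.2, sub_self]
      exact continuous_subtype_val.continuousAt.eventually
        (eventually_eq_of_frameDeriv_eq_zero ((hV i).inter (hV j))
          (fun y hy ↦ hVU i hy.1) (((hf i).mono Set.inter_subset_left).sub
            ((hf j).mono Set.inter_subset_right)) h0 ⟨hxi, hxj⟩))
  -- The value 0 off `U` is harmless: `U` is open, so only values on `U` matter near its points.
  have hloc : ∀ x : U, ∃ c, (fun y ↦ if hy : y ∈ U then h ⟨y, hy⟩ else 0)
      =ᶠ[nhds (x : M)] fun y ↦ f x y + c := fun x ↦ by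
    obtain ⟨c, hc⟩ := hh x
    refine ⟨c, ?_⟩
    rw [← map_nhds_subtype_coe_eq_nhds x.2 (hU.mem_nhds x.2)]
    refine Filter.eventually_map.2 (hc.mono fun y hy ↦ ?_)
    simp [hy]
  refine ⟨fun y ↦ if hy : y ∈ U then h ⟨y, hy⟩ else 0, fun x hx ↦ ?_, fun x hx a ↦ ?_⟩
  · obtain ⟨c, hc⟩ := hloc ⟨x, hx⟩
    exact ((((hf ⟨x, hx⟩).contMDiffAt ((hV _).mem_nhds (hxV ⟨x, hx⟩))).add
      contMDiffAt_const).congr_of_eventuallyEq hc).contMDiffWithinAt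
  · obtain ⟨c, hc⟩ := hloc ⟨x, hx⟩
    rw [(((hasFrameDeriv_frameDeriv (hfd ⟨x, hx⟩ x (hxV ⟨x, hx⟩))).add
      (hasFrameDeriv_const c)).congr_of_eventuallyEq hc).2, add_zero, hfS _ _ (hxV ⟨x, hx⟩)]

end Global

/-! ### Smoothness of the connection coefficients -/

section SmoothConnection

variable {F : SpinFrame g U} {x : M}

/-- Koszul's formula for the connection coefficients in an orthonormal tetrad. -/
lemma inner_cov_eq (hcov : IsLeviCivita g cov) (hU : IsOpen U) (hx : x ∈ U) (μ ν ρ : Fin 4) :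
    g.inner x (cov (F.e ν) x (F.e μ x)) (F.e ρ x) = 1 / 2 *
      (g.inner x (VectorField.mlieBracket 𝓘(ℝ, E4) (F.e μ) (F.e ν) x) (F.e ρ x)
        - g.inner x (VectorField.mlieBracket 𝓘(ℝ, E4) (F.e ν) (F.e ρ) x) (F.e μ x)
        + g.inner x (VectorField.mlieBracket 𝓘(ℝ, E4) (F.e ρ) (F.e μ) x) (F.e ν x)) := by
  have ht : ∀ μ ν ρ, g.inner x (VectorField.mlieBracket 𝓘(ℝ, E4) (F.e μ) (F.e ν) x) (F.e ρ x)
      = g.inner x (cov (F.e ν) x (F.e μ x)) (F.e ρ x)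
        - g.inner x (cov (F.e μ) x (F.e ν x)) (F.e ρ x) := fun μ ν ρ ↦ by
    rw [← cov.torsion_eq_zero_iff.1 hcov.torsion_free (F.mdifferentiableAt hU hx μ)
      (F.mdifferentiableAt hU hx ν), map_sub]
    rfl
  rw [ht, ht, ht]
  -- Of the six terms four cancel in pairs by metric antisymmetry, and the other two coincide.
  linarith [inner_cov_antisymm (F := F) hcov hU hx μ ν ρ,
    inner_cov_antisymm (F := F) hcov hU hx ν μ ρ, inner_cov_antisymm (F := F) hcov hU hx ρ μ ν]

/-- Koszul's formula involves only the metric and brackets of the tetrad, so their smoothness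
suffices. -/
lemma contMDiffOn_inner_cov (hcov : IsLeviCivita g cov) (hU : IsOpen U) (μ ν ρ : Fin 4) :
    ContMDiffOn 𝓘(ℝ, E4) 𝓘(ℝ, ℝ) ∞
      (fun x ↦ g.inner x (cov (F.e ν) x (F.e μ x)) (F.e ρ x)) U := by
  have h1 : ∀ μ ν ρ, ContMDiffOn 𝓘(ℝ, E4) 𝓘(ℝ, ℝ) ∞ (fun x ↦
      g.inner x (VectorField.mlieBracket 𝓘(ℝ, E4) (F.e μ) (F.e ν) x) (F.e ρ x)) U := by
    intro μ ν ρ x hx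
    have : IsManifold 𝓘(ℝ, E4) ((⊤ : ℕ∞) + 1) M := by simpa
    have : IsManifold 𝓘(ℝ, E4) (minSmoothness ℝ 2) M := IsManifold.of_le (n := ∞) (by
      rw [minSmoothness_of_isRCLikeNormedField]
      exact WithTop.coe_le_coe.2 le_top)
    have hb := ContMDiffAt.mlieBracket_vectorField (m := ⊤) (n := ⊤) (F.contMDiffAt hU hx μ)
      (F.contMDiffAt hU hx ν) (by rw [minSmoothness_of_isRCLikeNormedField]; simp)
    have h2 := ContMDiffAt.clm_bundle_apply₂ (F₁ := E4) (F₂ := E4) (F₃ := ℝ)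
      (E₃ := Bundle.Trivial M ℝ) (g.contMDiff x) hb (F.contMDiffAt hU hx ρ)
    exact ((Bundle.contMDiffAt_section _).1 h2).contMDiffWithinAt
  refine ((contMDiff_const (c := (1 / 2 : ℝ))).contMDiffOn.mul
    (((h1 μ ν ρ).sub (h1 ν ρ μ)).add (h1 ρ μ ν))).congr fun x hx ↦ ?_
  exact inner_cov_eq hcov hU hx μ ν ρ

end SmoothConnection

end RainichThree

namespace RainichThree

/-! ### Smooth fields of cubics -/

section SmoothCubic

variable {M : Type*} [TopologicalSpace M] [ChartedSpace E4 M] {U : Set M} {P N : M → Cubic}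

open RainichThree.Cubic

lemma contMDiffOn_const_mul (c : ℂ) {f : M → ℂ} (hf : ContMDiffOn 𝓘(ℝ, E4) 𝓘(ℝ, ℂ) ∞ f U) :
    ContMDiffOn 𝓘(ℝ, E4) 𝓘(ℝ, ℂ) ∞ (fun x ↦ c * f x) U :=
  contMDiffOn_complex_mul contMDiffOn_const hf

lemma contMDiffOn_raise (hP : SmoothSpinorOn P U) (B C D : Fin 2) :
    ContMDiffOn 𝓘(ℝ, E4) 𝓘(ℝ, ℂ) ∞ (fun x ↦ raise (P x) B C D) U :=
  contMDiffOn_finsetSum fun _ _ ↦ contMDiffOn_finsetSum fun _ _ ↦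
    contMDiffOn_const_mul _ (hP _ _ _)

lemma contMDiffOn_hessian (hP : SmoothSpinorOn P U) (A B : Fin 2) :
    ContMDiffOn 𝓘(ℝ, E4) 𝓘(ℝ, ℂ) ∞ (fun x ↦ hessian (P x) A B) U :=
  contMDiffOn_finsetSum fun _ _ ↦ contMDiffOn_finsetSum fun _ _ ↦
    contMDiffOn_complex_mul (hP _ _ _) (contMDiffOn_raise hP _ _ _)

lemma contMDiffOn_disc (hP : SmoothSpinorOn P U) :
    ContMDiffOn 𝓘(ℝ, E4) 𝓘(ℝ, ℂ) ∞ (fun x ↦ disc (P x)) U :=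
  contMDiffOn_const_mul _
    ((contMDiffOn_complex_mul (contMDiffOn_hessian hP _ _) (contMDiffOn_hessian hP _ _)).sub
      (contMDiffOn_complex_mul (contMDiffOn_hessian hP _ _) (contMDiffOn_hessian hP _ _)))

lemma contMDiffOn_jacobian (hP : SmoothSpinorOn P U) (E C D : Fin 2) :
    ContMDiffOn 𝓘(ℝ, E4) 𝓘(ℝ, ℂ) ∞ (fun x ↦ jacobian (P x) E C D) U :=
  contMDiffOn_finsetSum fun _ _ ↦ contMDiffOn_finsetSum fun _ _ ↦
    contMDiffOn_complex_mul (contMDiffOn_const_mul _ (contMDiffOn_hessian hP _ _))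
      (contMDiffOn_raise hP _ _ _)

lemma contMDiffOn_divPair {N : Fin 2 → M → Cubic} (hP : SmoothSpinorOn P U)
    (hN : ∀ d, SmoothSpinorOn (N d) U) (H : Fin 2) :
    ContMDiffOn 𝓘(ℝ, E4) 𝓘(ℝ, ℂ) ∞ (fun x ↦ divPair (P x) (fun d ↦ N d x) H) U :=
  contMDiffOn_finsetSum fun _ _ ↦ contMDiffOn_finsetSum fun _ _ ↦ contMDiffOn_const_mul _ <|
    contMDiffOn_finsetSum fun _ _ ↦ contMDiffOn_finsetSum fun _ _ ↦
      contMDiffOn_complex_mul (contMDiffOn_jacobian hP _ _ _) (hN _ _ _ _)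

lemma contMDiffOn_complex_div {f h : M → ℂ} (hf : ContMDiffOn 𝓘(ℝ, E4) 𝓘(ℝ, ℂ) ∞ f U)
    (hh : ContMDiffOn 𝓘(ℝ, E4) 𝓘(ℝ, ℂ) ∞ h U) (h0 : ∀ x ∈ U, h x ≠ 0) :
    ContMDiffOn 𝓘(ℝ, E4) 𝓘(ℝ, ℂ) ∞ (fun x ↦ f x / h x) U := by
  simp only [div_eq_mul_inv]
  exact contMDiffOn_complex_mul hf fun x hx ↦
    (contDiffAt_inv ℝ (h0 x hx)).contMDiffAt.comp_contMDiffWithinAt x (hh x hx)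

lemma contMDiffOn_conj {f : M → ℂ} (hf : ContMDiffOn 𝓘(ℝ, E4) 𝓘(ℝ, ℂ) ∞ f U) :
    ContMDiffOn 𝓘(ℝ, E4) 𝓘(ℝ, ℂ) ∞ (fun x ↦ conj (f x)) U :=
  Complex.conjCLE.contDiff.contMDiff.comp_contMDiffOn hf

lemma SmoothSpinorOn.mdifferentiableAt {Φ : Spinor3 M} (hΦ : SmoothSpinorOn Φ U) (hU : IsOpen U) {x : M} (hx : x ∈ U)
    (A B C : Fin 2) : MDifferentiableAt 𝓘(ℝ, E4) 𝓘(ℝ, ℂ) (fun y ↦ Φ y A B C) x :=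
  ((hΦ A B C).contMDiffAt (hU.mem_nhds hx)).mdifferentiableAt (by simp)

end SmoothCubic

section ConjCubic

open RainichThree.Cubic

variable (P : Cubic)

lemma conj_eps (A B : Fin 2) : conj (eps A B) = eps A B := by
  fin_cases A <;> fin_cases B <;> simp [eps]

lemma conj_disc : conj (disc P) = disc fun A B C ↦ conj (P A B C) := by
  simp only [disc, hessian, raise, map_mul, map_sub, map_sum, map_ofNat, conj_eps]

lemma conj_divPair (N : Fin 2 → Cubic) (H : Fin 2) :
    conj (divPair P N H) = divPair (fun A B C ↦ conj (P A B C))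
      (fun d A B C ↦ conj (N d A B C)) H := by
  simp only [divPair, pair, jacobian, hessian, raise, map_mul, map_sum, conj_eps]

lemma conj_discDeriv (N : Cubic) :
    conj (discDeriv P N) = discDeriv (fun A B C ↦ conj (P A B C)) fun A B C ↦ conj (N A B C) := by
  simp only [discDeriv, pair, jacobian, hessian, raise, map_mul, map_neg, map_sum, map_ofNat,
    conj_eps]

variable {P}

lemma Cubic.IsSymm.conj (hP : P.IsSymm) : IsSymm fun A B C ↦ conj (P A B C) := fun A B C ↦
  ⟨congrArg _ (hP A B C).1, congrArg _ (hP A B C).2⟩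

lemma quartic_superenergy {M : Type*} {x : M} {Φ : Spinor3 M} {T : Tensor3 M}
    (hsym : IsSymmSpinor Φ x) (hT : T x = superenergy Φ x) :
    quartic T x = Cubic.disc (Φ x) * conj (Cubic.disc (Φ x)) := by
  rw [conj_disc]
  exact quartic_eq hsym (Cubic.IsSymm.conj hsym) hT

end ConjCubic

variable {M : Type*} [TopologicalSpace M] [ChartedSpace E4 M] [IsManifold 𝓘(ℝ, E4) ∞ M]
  {g : LorentzMetric M} {U : Set M}
  {cov : CovariantDerivative 𝓘(ℝ, E4) E4 (TangentSpace 𝓘(ℝ, E4) : M → Type)}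
  {F : SpinFrame g U} {x : M}

/-! ### Smoothness of covariant derivatives -/

lemma contMDiffOn_conn (hcov : IsLeviCivita g cov) (hU : IsOpen U) (a b c : Idx) :
    ContMDiffOn 𝓘(ℝ, E4) 𝓘(ℝ, ℂ) ∞ (fun x ↦ conn cov F x a b c) U :=
  contMDiffOn_finsetSum fun μ _ ↦ contMDiffOn_finsetSum fun ν _ ↦ contMDiffOn_finsetSum fun ρ _ ↦
    contMDiffOn_const_mul _
      (Complex.ofRealCLM.contMDiff.comp_contMDiffOn (contMDiffOn_inner_cov hcov hU μ ν ρ))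

lemma contMDiffOn_spinConnUp (hcov : IsLeviCivita g cov) (hU : IsOpen U) (a : Idx) (B C : Fin 2) :
    ContMDiffOn 𝓘(ℝ, E4) 𝓘(ℝ, ℂ) ∞ (fun x ↦ spinConnUp cov F x a B C) U :=
  contMDiffOn_finsetSum fun _ _ ↦ contMDiffOn_const_mul _ <| contMDiffOn_const_mul _ <|
    contMDiffOn_finsetSum fun _ _ ↦ contMDiffOn_finsetSum fun _ _ ↦
      contMDiffOn_const_mul _ (contMDiffOn_conn hcov hU _ _ _)

lemma smoothSpinorOn_nablaSpinor (hcov : IsLeviCivita g cov) (hU : IsOpen U) {Φ : Spinor3 M}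
    (hΦ : SmoothSpinorOn Φ U) (d : Idx) :
    SmoothSpinorOn (fun x ↦ nablaSpinor cov F Φ x d) U := fun A B C ↦
  (contMDiffOn_frameDeriv hU (hΦ A B C) d).sub <| contMDiffOn_finsetSum fun _ _ ↦
    ((contMDiffOn_complex_mul (contMDiffOn_spinConnUp hcov hU _ _ _) (hΦ _ _ _)).add
      (contMDiffOn_complex_mul (contMDiffOn_spinConnUp hcov hU _ _ _) (hΦ _ _ _))).add
      (contMDiffOn_complex_mul (contMDiffOn_spinConnUp hcov hU _ _ _) (hΦ _ _ _))

/-! ### The curl of a sum, and of a logarithmic gradient -/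

/-- The restriction of a tetrad to a smaller region. -/
def SpinFrame.mono (F : SpinFrame g U) {V : Set M} (hVU : V ⊆ U) : SpinFrame g V where
  e := F.e
  contMDiffOn μ := (F.contMDiffOn μ).mono hVU
  orthonormal x hx := F.orthonormal x (hVU hx)

lemma curl_congr {S S' : M → Idx → ℂ} (h : S =ᶠ[nhds x] S') (a b : Idx) :
    curl cov F S x a b = curl cov F S' x a b := by
  simp only [curl, nablaCovector, h.eq_of_nhds]
  rw [frameDeriv_congr (h.mono fun y hy ↦ congrFun hy b),
    frameDeriv_congr (h.mono fun y hy ↦ congrFun hy a)]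

lemma curl_add {S S' : M → Idx → ℂ}
    (hS : ∀ a, MDifferentiableAt 𝓘(ℝ, E4) 𝓘(ℝ, ℂ) (fun y ↦ S y a) x)
    (hS' : ∀ a, MDifferentiableAt 𝓘(ℝ, E4) 𝓘(ℝ, ℂ) (fun y ↦ S' y a) x) (a b : Idx) :
    curl cov F (fun y a ↦ S y a + S' y a) x a b = curl cov F S x a b + curl cov F S' x a b := by
  have h : ∀ a b, frameDeriv F a (fun y ↦ S y b + S' y b) x
      = frameDeriv F a (fun y ↦ S y b) x + frameDeriv F a (fun y ↦ S' y b) x := fun a b ↦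
    ((hasFrameDeriv_frameDeriv (hS b)).add (hasFrameDeriv_frameDeriv (hS' b))).2
  simp only [curl, nablaCovector, h, mul_add, Finset.sum_add_distrib]
  ring

variable (F) in
/-- The covector `-(i/8) (∇_a Δ / Δ - c.c.)`. -/
def logGradient (Δ : M → ℂ) (x : M) (a : Idx) : ℂ :=
  -(Complex.I / 8) * (frameDeriv F a Δ x / Δ x - conj (frameDeriv F a.swap Δ x / Δ x))

section LogGradient

variable {Δ : M → ℂ}

lemma contMDiffOn_logGradient (hU : IsOpen U) (hΔ : ContMDiffOn 𝓘(ℝ, E4) 𝓘(ℝ, ℂ) ∞ Δ U)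
    (hΔ0 : ∀ x ∈ U, Δ x ≠ 0) (a : Idx) :
    ContMDiffOn 𝓘(ℝ, E4) 𝓘(ℝ, ℂ) ∞ (fun x ↦ logGradient F Δ x a) U :=
  contMDiffOn_const_mul _ <|
    (contMDiffOn_complex_div (contMDiffOn_frameDeriv hU hΔ a) hΔ hΔ0).sub <|
      contMDiffOn_conj (contMDiffOn_complex_div (contMDiffOn_frameDeriv hU hΔ a.swap) hΔ hΔ0)

/-- Near each point this is the gradient of -(i/8)(log Δ - c.c.) = ¼ arg Δ up to a constant. The
curl is local, so no global logarithm is needed. -/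
lemma curl_logGradient (hcov : IsLeviCivita g cov) (hU : IsOpen U)
    (hΔ : ContMDiffOn 𝓘(ℝ, E4) 𝓘(ℝ, ℂ) ∞ Δ U) (hΔ0 : ∀ x ∈ U, Δ x ≠ 0) (hx : x ∈ U) (a b : Idx) :
    curl cov F (logGradient F Δ) x a b = 0 := by
  -- Dividing by Δ(x) gives the value 1 at x, inside the slit plane where the logarithm is smooth.
  have hq := contMDiffOn_const_mul (Δ x)⁻¹ hΔ
  have hV : IsOpen (U ∩ (fun y ↦ (Δ x)⁻¹ * Δ y) ⁻¹' Complex.slitPlane) :=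
    hq.continuousOn.isOpen_inter_preimage hU Complex.isOpen_slitPlane
  set V := U ∩ (fun y ↦ (Δ x)⁻¹ * Δ y) ⁻¹' Complex.slitPlane
  have hVU : V ⊆ U := Set.inter_subset_left
  have hlog : ContMDiffOn 𝓘(ℝ, E4) 𝓘(ℝ, ℂ) ∞ (fun y ↦ Complex.log ((Δ x)⁻¹ * Δ y)) V :=
    fun y hy ↦ ((Complex.contDiffAt_log hy.2).restrict_scalars ℝ).contMDiffAt
      |>.comp_contMDiffWithinAt y ((hq y hy.1).mono hVU)
  have hd : ∀ y ∈ V, ∀ a, HasFrameDeriv F a (fun y ↦ Complex.log ((Δ x)⁻¹ * Δ y))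
      (frameDeriv F a Δ y / Δ y) y := fun y hy a ↦ by
    have h1 := hasFrameDeriv_frameDeriv (F := F) (d := a)
      ((hΔ.contMDiffAt (hU.mem_nhds hy.1)).mdifferentiableAt (by simp))
    refine ((h1.const_mul (Δ x)⁻¹).comp (Complex.hasDerivAt_log hy.2)).congr_deriv ?_
    have := hΔ0 y hy.1
    have := hΔ0 x hx
    field_simp
  have hxV : x ∈ V := ⟨hx, by simp [hΔ0 x hx]⟩
  refine curl_frameDeriv (F := F.mono hVU) hcov hV
    (f := fun y ↦ -(Complex.I / 8) *
      (Complex.log ((Δ x)⁻¹ * Δ y) - conj (Complex.log ((Δ x)⁻¹ * Δ y))))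
    (contMDiffOn_const_mul _ (hlog.sub (contMDiffOn_conj hlog))) (fun y hy a ↦ ?_) hxV a b
  exact (((hd y hy a).sub (hd y hy a.swap).conj).const_mul _).2.symm

end LogGradient

/-! ### The rotation covector of a spinor field -/

section Rotation

variable {Φ : Spinor3 M} {T : Tensor3 M}

variable (cov F Φ) in
/-- The covector `w_{HY}` obtained by contracting `∇^A_Y Φ_{ACD}` with the cubic covariant of `Φ`
and dividing by the discriminant. -/
def rotation (x : M) (a : Idx) : ℂ :=
  divPair (Φ x) (fun d ↦ nablaSpinor cov F Φ x (d, a.2)) a.1 / Cubic.disc (Φ x)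

lemma contMDiffOn_rotation (hcov : IsLeviCivita g cov) (hU : IsOpen U) (hΦ : SmoothSpinorOn Φ U)
    (hdisc : ∀ x ∈ U, Cubic.disc (Φ x) ≠ 0) (a : Idx) :
    ContMDiffOn 𝓘(ℝ, E4) 𝓘(ℝ, ℂ) ∞ (fun x ↦ rotation cov F Φ x a) U :=
  contMDiffOn_complex_div (contMDiffOn_divPair hΦ
    (fun _ ↦ smoothSpinorOn_nablaSpinor hcov hU hΦ _) _) (contMDiffOn_disc hΦ) hdisc

/-- The covector `S` of `Φ_{ABC} Φ̄_{A'B'C'}`. -/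
lemma covectorS_superenergy (hcov : IsLeviCivita g cov) (hU : IsOpen U) (hΦ : SmoothSpinorOn Φ U)
    (hsym : ∀ x ∈ U, IsSymmSpinor Φ x) (hT : ∀ x ∈ U, T x = superenergy Φ x)
    (hdisc : ∀ x ∈ U, Cubic.disc (Φ x) ≠ 0) (hx : x ∈ U) (a : Idx) :
    covectorS cov F T x a
      = -Complex.I * (rotation cov F Φ x a - conj (rotation cov F Φ x a.swap))
        + logGradient F (fun y ↦ Cubic.disc (Φ y)) x a := by
  have hev : ∀ᶠ y in nhds x, y ∈ U := hU.mem_nhds hx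
  have hd := fun d ↦ (hasFrameDeriv_disc (F := F) hcov hU hx (hΦ.mdifferentiableAt hU hx)
    (hev.mono hsym) d).2
  have hc : Cubic.disc (fun A B C ↦ conj (Φ x A B C)) ≠ 0 := by
    rw [← conj_disc]
    exact (map_ne_zero _).2 (hdisc x hx)
  rw [covectorS_eq (hsym x hx) (hdisc x hx) (Cubic.IsSymm.conj (hsym x hx)) hc (hT x hx)
    (nablaSpinor cov F Φ x) (fun d A B C ↦ conj (nablaSpinor cov F Φ x d.swap A B C))
    (nablaTensor_superenergy hcov hU hx (hΦ.mdifferentiableAt hU hx) (hev.mono hT))]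
  simp only [rotation, logGradient, hd, map_div₀, conj_disc, conj_divPair, conj_discDeriv,
    Prod.fst_swap, Prod.snd_swap, Prod.swap_prod_mk]
  ring

lemma sum_met_eq_zero (hcov : IsLeviCivita g cov) (hU : IsOpen U) (hΦ : SmoothSpinorOn Φ U)
    (hT : ∀ x ∈ U, T x = superenergy Φ x) (hx : x ∈ U)
    (hdiv : ∀ b c, divTensor cov F T x b c = 0) (b c : Idx) :
    ∑ a, ∑ d, met a d * (nablaSpinor cov F Φ x d a.1 b.1 c.1 * conj (Φ x a.2 b.2 c.2)
      + Φ x a.1 b.1 c.1 * conj (nablaSpinor cov F Φ x d.swap a.2 b.2 c.2)) = 0 := by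
  have hev : ∀ᶠ y in nhds x, y ∈ U := hU.mem_nhds hx
  rw [← hdiv b c]
  simp only [divTensor, nablaTensor_superenergy hcov hU hx (hΦ.mdifferentiableAt hU hx)
    (hev.mono hT)]

/-- The rotation covector of a spinor field whose tensor is divergence-free is anti-Hermitian. -/
lemma conj_rotation_swap (hcov : IsLeviCivita g cov) (hU : IsOpen U) (hΦ : SmoothSpinorOn Φ U)
    (hsym : ∀ x ∈ U, IsSymmSpinor Φ x) (hT : ∀ x ∈ U, T x = superenergy Φ x)
    (hdisc : ∀ x ∈ U, Cubic.disc (Φ x) ≠ 0) (hx : x ∈ U)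
    (hdiv : ∀ b c, divTensor cov F T x b c = 0) (a : Idx) :
    conj (rotation cov F Φ x a.swap) = -rotation cov F Φ x a := by
  have hc : Cubic.disc (fun A B C ↦ conj (Φ x A B C)) ≠ 0 := by
    rw [← conj_disc]
    exact (map_ne_zero _).2 (hdisc x hx)
  have h := divPair_div_disc_of_div_eq_zero (hsym x hx) (hdisc x hx)
    (Cubic.IsSymm.conj (hsym x hx)) hc (nablaSpinor cov F Φ x)
    (fun d A B C ↦ conj (nablaSpinor cov F Φ x d.swap A B C))
    (sum_met_eq_zero hcov hU hΦ hT hx hdiv) a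
  simp only [rotation, h, neg_neg, map_div₀, conj_disc, conj_divPair, Prod.fst_swap,
    Prod.snd_swap, Prod.swap_prod_mk]

/-- The divergence of `Φ` is determined by its rotation covector. -/
lemma spinorDiv_nablaSpinor (hcov : IsLeviCivita g cov) (hU : IsOpen U) (hΦ : SmoothSpinorOn Φ U)
    (hsym : ∀ x ∈ U, IsSymmSpinor Φ x) (hT : ∀ x ∈ U, T x = superenergy Φ x)
    (hdisc : ∀ x ∈ U, Cubic.disc (Φ x) ≠ 0) (hx : x ∈ U)
    (hdiv : ∀ b c, divTensor cov F T x b c = 0) (Y B C : Fin 2) :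
    spinorDiv (fun d ↦ nablaSpinor cov F Φ x (d, Y)) B C
      = -2 * ∑ A, ∑ X, eps A X * Φ x A B C * rotation cov F Φ x (X, Y) := by
  have hc : Cubic.disc (fun A B C ↦ conj (Φ x A B C)) ≠ 0 := by
    rw [← conj_disc]
    exact (map_ne_zero _).2 (hdisc x hx)
  rw [spinorDiv_eq_of_div_eq_zero (Cubic.IsSymm.conj (hsym x hx)) hc (nablaSpinor cov F Φ x)
    (fun d A B C ↦ conj (nablaSpinor cov F Φ x d.swap A B C))
    (sum_met_eq_zero hcov hU hΦ hT hx hdiv) Y B C]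
  have h : ∀ X, divPair (fun A B C ↦ conj (Φ x A B C))
      (fun d A B C ↦ conj (nablaSpinor cov F Φ x (X, d).swap A B C)) Y
        / Cubic.disc (fun A B C ↦ conj (Φ x A B C)) = -rotation cov F Φ x (X, Y) := fun X ↦ by
    rw [← conj_rotation_swap hcov hU hΦ hsym hT hdisc hx hdiv]
    simp only [rotation, map_div₀, conj_disc, conj_divPair, Prod.swap_prod_mk]
  simp only [h, mul_neg, Finset.sum_neg_distrib, neg_mul]

lemma divSpinor_eq (x : M) (A₁ B C : Fin 2) :
    divSpinor cov F Φ x A₁ B C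
      = ∑ D₁, eps A₁ D₁ * spinorDiv (fun d ↦ nablaSpinor cov F Φ x (d, D₁)) B C := by
  simp only [divSpinor, spinorDiv, Fin.sum_univ_two]
  ring

/-- The rotation covector of a massless field vanishes. -/
lemma rotation_eq_zero (h : ∀ A₁ B C, divSpinor cov F Φ x A₁ B C = 0) (a : Idx) :
    rotation cov F Φ x a = 0 := by
  have h1 : ∀ D₁ B C, spinorDiv (fun d ↦ nablaSpinor cov F Φ x (d, D₁)) B C = 0 := by
    intro D₁ B C
    have h0 := h 0 B C
    have h1 := h 1 B C
    simp [divSpinor_eq, Fin.sum_univ_two] at h0 h1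
    fin_cases D₁ <;> simp [h0, h1]
  simp [rotation, divPair_eq, h1]

end Rotation

/-! ### From closedness of S to massless fields and back -/

section Main

variable {Φ Ψ : Spinor3 M} {T : Tensor3 M} {V : Set M}

lemma IsMasslessFactor.mono_frame (h : IsMasslessFactor cov F T V Ψ) (hVU : V ⊆ U) :
    IsMasslessFactor cov (F.mono hVU) T V Ψ :=
  ⟨h.smooth, h.symm, h.factor, h.field_eq⟩

/-- If `T` comes from a massless field, then `S` has no curl. -/
lemma IsMasslessFactor.curl_covectorS (hcov : IsLeviCivita g cov) (hU : IsOpen U)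
    (h : IsMasslessFactor cov F T U Ψ) (hT : ∀ x ∈ U, quartic T x ≠ 0) (hx : x ∈ U) (a b : Idx) :
    curl cov F (covectorS cov F T) x a b = 0 := by
  have hdisc : ∀ x ∈ U, Cubic.disc (Ψ x) ≠ 0 := fun x hx h0 ↦
    hT x hx (by rw [quartic_superenergy (h.symm x hx) (h.factor x hx), h0, zero_mul])
  rw [← curl_logGradient (F := F) hcov hU (contMDiffOn_disc h.smooth) hdisc hx a b]
  refine curl_congr (Filter.eventually_of_mem (hU.mem_nhds hx) fun y hy ↦ funext fun c ↦ ?_) a b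
  -- S is built from T alone, so the formula applies with Ψ as the spinor; the field equation
  -- removes its rotation term.
  rw [covectorS_superenergy hcov hU h.smooth h.symm h.factor hdisc hy]
  simp [rotation_eq_zero (h.field_eq y hy)]

/-- The Leibniz rule. -/
lemma nablaSpinor_mul {k : M → ℂ} {k' : ℂ} {d : Idx} (hk : HasFrameDeriv F d k k' x)
    (hΦ : ∀ A B C, MDifferentiableAt 𝓘(ℝ, E4) 𝓘(ℝ, ℂ) (fun y ↦ Φ y A B C) x) (A B C : Fin 2) :
    nablaSpinor cov F (fun y A B C ↦ k y * Φ y A B C) x d A B C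
      = k' * Φ x A B C + k x * nablaSpinor cov F Φ x d A B C := by
  simp only [nablaSpinor, (hk.mul (hasFrameDeriv_frameDeriv (hΦ A B C))).2, mul_sub,
    Finset.mul_sum]
  rw [← add_sub_assoc]
  refine congrArg _ (Finset.sum_congr rfl fun D _ ↦ ?_)
  ring

/-- A phase whose gradient is the rotation covector turns `Φ` into a massless field. -/
lemma exists_isMasslessFactor (hcov : IsLeviCivita g cov) (hU : IsOpen U)
    (hΦ : SmoothSpinorOn Φ U) (hsym : ∀ x ∈ U, IsSymmSpinor Φ x)
    (hT : ∀ x ∈ U, T x = superenergy Φ x) (hdisc : ∀ x ∈ U, Cubic.disc (Φ x) ≠ 0)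
    (hdiv : ∀ x ∈ U, ∀ b c, divTensor cov F T x b c = 0) (hV : IsOpen V) (hVU : V ⊆ U)
    {f : M → ℂ} (hf : ContMDiffOn 𝓘(ℝ, E4) 𝓘(ℝ, ℂ) ∞ f V)
    (hfd : ∀ x ∈ V, ∀ a, frameDeriv F a f x = -2 * Complex.I * rotation cov F Φ x a) :
    ∃ Ψ : Spinor3 M, IsMasslessFactor cov F T V Ψ := by
  -- The phase must be real for `T` to be preserved. Since -2iw is a real covector, the real part of
  -- f has the same gradient as f.
  have hθ : ContMDiffOn 𝓘(ℝ, E4) 𝓘(ℝ, ℂ) ∞ (fun x ↦ 1 / 2 * (f x + conj (f x))) V :=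
    contMDiffOn_const_mul _ (hf.add (contMDiffOn_conj hf))
  have hk : ∀ x ∈ V, ∀ a, HasFrameDeriv F a
      (fun x ↦ Complex.exp (Complex.I * (1 / 2 * (f x + conj (f x)))))
      (Complex.exp (Complex.I * (1 / 2 * (f x + conj (f x)))) * (2 * rotation cov F Φ x a)) x := by
    intro x hx a
    have h1 := fun a ↦ hasFrameDeriv_frameDeriv (F := F) (d := a)
      ((hf.contMDiffAt (hV.mem_nhds hx)).mdifferentiableAt (by simp))
    have h2 := ((((h1 a).add (h1 a.swap).conj).const_mul (1 / 2)).const_mul Complex.I).comp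
      (Complex.hasDerivAt_exp _)
    rw [hfd x hx, hfd x hx, map_mul, conj_rotation_swap hcov hU hΦ hsym hT hdisc (hVU hx)
      (hdiv x (hVU hx))] at h2
    refine h2.congr_deriv ?_
    simp only [map_mul, map_neg, map_ofNat, Complex.conj_I]
    linear_combination (-2 * Complex.exp (Complex.I * (1 / 2 * (f x + conj (f x))))
      * rotation cov F Φ x a) * Complex.I_sq
  refine ⟨fun x A B C ↦ Complex.exp (Complex.I * (1 / 2 * (f x + conj (f x)))) * Φ x A B C,
    fun A B C ↦ contMDiffOn_complex_mul ?_ ((hΦ A B C).mono hVU),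
    fun x hx A B C ↦ ⟨congrArg _ (hsym x (hVU hx) A B C).1, congrArg _ (hsym x (hVU hx) A B C).2⟩,
    fun x hx ↦ ?_, fun x hx A₁ B C ↦ ?_⟩
  · exact (Complex.contDiff_exp (𝕜 := ℝ)).contMDiff.comp_contMDiffOn
      (contMDiffOn_const_mul _ hθ)
  · have h1 : Complex.exp (Complex.I * (1 / 2 * (f x + conj (f x))))
        * conj (Complex.exp (Complex.I * (1 / 2 * (f x + conj (f x))))) = 1 := by
      rw [← Complex.exp_conj, ← Complex.exp_add, Complex.exp_eq_one_iff]
      refine ⟨0, ?_⟩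
      simp [map_ofNat]
      ring
    rw [hT x (hVU hx)]
    funext a b c
    simp only [superenergy, map_mul]
    linear_combination (-Φ x a.1 b.1 c.1 * conj (Φ x a.2 b.2 c.2)) * h1
  · rw [divSpinor_eq]
    refine Finset.sum_eq_zero fun Y _ ↦ ?_
    have h1 := spinorDiv_nablaSpinor hcov hU hΦ hsym hT hdisc (hVU hx) (hdiv x (hVU hx)) Y B C
    have hΦd := hΦ.mdifferentiableAt hU (hVU hx)
    simp only [spinorDiv, Fin.sum_univ_two] at h1
    simp only [spinorDiv, Fin.sum_univ_two, nablaSpinor_mul (hk x hx _) hΦd]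
    -- The gradient of the phase contributes +2w, cancelling the -2w in the divergence of Φ.
    linear_combination (eps A₁ Y * Complex.exp (Complex.I * (1 / 2 * (f x + conj (f x))))) * h1

/-- If `S` has no curl, then neither has the rotation covector. -/
lemma curl_rotation (hcov : IsLeviCivita g cov) (hU : IsOpen U)
    (hΦ : SmoothSpinorOn Φ U) (hsym : ∀ x ∈ U, IsSymmSpinor Φ x)
    (hT : ∀ x ∈ U, T x = superenergy Φ x) (hdisc : ∀ x ∈ U, Cubic.disc (Φ x) ≠ 0)
    (hdiv : ∀ x ∈ U, ∀ b c, divTensor cov F T x b c = 0) (hx : x ∈ U) (a b : Idx)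
    (hS : curl cov F (covectorS cov F T) x a b = 0) :
    curl cov F (fun x a ↦ -2 * Complex.I * rotation cov F Φ x a) x a b = 0 := by
  -- Anti-Hermiticity turns -i(w - w̄) into -2iw.
  have h1 : covectorS cov F T =ᶠ[nhds x] fun y c ↦ -2 * Complex.I * rotation cov F Φ y c
      + logGradient F (fun y ↦ Cubic.disc (Φ y)) y c :=
    Filter.eventually_of_mem (hU.mem_nhds hx) fun y hy ↦ funext fun c ↦ by
      rw [covectorS_superenergy hcov hU hΦ hsym hT hdisc hy,
        conj_rotation_swap hcov hU hΦ hsym hT hdisc hy (hdiv y hy)]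
      ring
  have hmd : ∀ {f : M → ℂ}, ContMDiffOn 𝓘(ℝ, E4) 𝓘(ℝ, ℂ) ∞ f U →
      MDifferentiableAt 𝓘(ℝ, E4) 𝓘(ℝ, ℂ) f x := fun hf ↦
    (hf.contMDiffAt (hU.mem_nhds hx)).mdifferentiableAt (by simp)
  rw [curl_congr h1, curl_add
    (fun c ↦ hmd (contMDiffOn_const_mul _ (contMDiffOn_rotation hcov hU hΦ hdisc c)))
    (fun c ↦ hmd (contMDiffOn_logGradient hU (contMDiffOn_disc hΦ) hdisc c)),
    curl_logGradient hcov hU (contMDiffOn_disc hΦ) hdisc hx, add_zero] at hS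
  exact hS

end Main

end RainichThree

end

/-! ### The local and the global equivalence -/

theorem mainTheorem4 {M : Type*} [TopologicalSpace M] [T2Space M] [ChartedSpace RainichThree.E4 M]
    [IsManifold 𝓘(ℝ, RainichThree.E4) ∞ M]
    (g : RainichThree.LorentzMetric M)
    (cov : CovariantDerivative 𝓘(ℝ, RainichThree.E4) RainichThree.E4
      (TangentSpace 𝓘(ℝ, RainichThree.E4) : M → Type))
    (hcov : RainichThree.IsLeviCivita g cov)
    (U : Set M) (hU : IsOpen U) (F : RainichThree.SpinFrame g U)
    (T : RainichThree.Tensor3 M) (Φ : RainichThree.Spinor3 M)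
    (hΦ_smooth : RainichThree.SmoothSpinorOn Φ U)
    (hΦ_symm : ∀ x ∈ U, RainichThree.IsSymmSpinor Φ x)
    (hT : ∀ x ∈ U, T x = RainichThree.superenergy Φ x)
    (hdiv : ∀ x ∈ U, ∀ b c, RainichThree.divTensor cov F T x b c = 0)
    (htypeI : ∀ x ∈ U, RainichThree.quartic T x ≠ 0) :
    ((∀ x ∈ U, ∃ V : Set M, IsOpen V ∧ x ∈ V ∧ V ⊆ U ∧
        ∃ Ψ : RainichThree.Spinor3 M, RainichThree.IsMasslessFactor cov F T V Ψ) ↔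
      ∀ x ∈ U, ∀ a b,
        RainichThree.nablaCovector cov F (RainichThree.covectorS cov F T) x a b
          = RainichThree.nablaCovector cov F (RainichThree.covectorS cov F T) x b a) ∧
    (SimplyConnectedSpace U →
      ((∃ Ψ : RainichThree.Spinor3 M, RainichThree.IsMasslessFactor cov F T U Ψ) ↔
        ∀ x ∈ U, ∀ a b,
          RainichThree.nablaCovector cov F (RainichThree.covectorS cov F T) x a b
            = RainichThree.nablaCovector cov F (RainichThree.covectorS cov F T) x b a)) := by
  have hdisc : ∀ x ∈ U, RainichThree.Cubic.disc (Φ x) ≠ 0 := fun x hx h0 ↦ htypeI x hx <| by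
    rw [RainichThree.quartic_superenergy (hΦ_symm x hx) (hT x hx), h0, zero_mul]
  have hw : ∀ a, ContMDiffOn 𝓘(ℝ, RainichThree.E4) 𝓘(ℝ, ℂ) ∞
      (fun x ↦ -2 * Complex.I * RainichThree.rotation cov F Φ x a) U := fun a ↦
    RainichThree.contMDiffOn_const_mul _
      (RainichThree.contMDiffOn_rotation hcov hU hΦ_smooth hdisc a)
  refine ⟨⟨fun h x hx a b ↦ ?_, fun h x hx ↦ ?_⟩, fun hsc ↦ ⟨fun ⟨Ψ, hΨ⟩ x hx a b ↦ ?_, fun h ↦ ?_⟩⟩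
  · obtain ⟨V, hV, hxV, hVU, Ψ, hΨ⟩ := h x hx
    -- The curl at x is local, so the tetrad may be restricted to the neighbourhood carrying Ψ.
    exact sub_eq_zero.1 <| (hΨ.mono_frame hVU).curl_covectorS hcov hV
      (fun y hy ↦ htypeI y (hVU hy)) hxV a b
  · obtain ⟨V, hV, hxV, hVU, f, hf, hfd⟩ := RainichThree.exists_local_primitive hcov hU hw
      (fun y hy a b ↦ RainichThree.curl_rotation hcov hU hΦ_smooth hΦ_symm hT hdisc hdiv hy a b
        (sub_eq_zero.2 (h y hy a b))) hx
    exact ⟨V, hV, hxV, hVU, RainichThree.exists_isMasslessFactor hcov hU hΦ_smooth hΦ_symm hT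
      hdisc hdiv hV hVU hf hfd⟩
  · exact sub_eq_zero.1 (hΨ.curl_covectorS hcov hU htypeI hx a b)
  · obtain ⟨f, hf, hfd⟩ := RainichThree.exists_global_primitive hcov hU hw
      fun y hy a b ↦ RainichThree.curl_rotation hcov hU hΦ_smooth hΦ_symm hT hdisc hdiv hy a b
        (sub_eq_zero.2 (h y hy a b))
    exact RainichThree.exists_isMasslessFactor hcov hU hΦ_smooth hΦ_symm hT
      hdisc hdiv hU subset_rfl hf hfd
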